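/- **Lemma A.1 (Fundamental solution).** For $\xi>0$ consider the linear delay equation with a point source $$\varphi'(x)=\varphi(x)-2\varphi(x/2)+\delta(x-\xi)\quad\text{for }x\in(0,\infty),\qquad \varphi(0)=0, \tag{1}$$ understood as follows: $\varphi$ is locally integrable on $(0,\infty)$, the equation holds in the sense of distributions on $(0,\infty)$, $\varphi(0)=0$, and $\varphi(x)\to 0$ as $x\to0^+$. For every $\xi>0$ the problem (1) has a solution $G(\cdot,\xi)$, which is continuous on $[0,\infty)\setminus\{\xi\}$; every solution of (1) coincides with it almost everywhere on $(0,\infty)$. It satisfies $G(x,\xi)=0$ for $x<\xi$ (where $G(\cdot,\xi)$ is extended by $0$ to negative $x$), and for $x>\xi$ it has the representation $$G(x,\xi)=e^xQ(\xi)+\widetilde G(x,\xi),\qquad Q(\xi):=e^{-\xi}+\sum_{n=1}^\infty\frac{(-1)^n2^{2n}e^{-2^n\xi}}{\prod_{j=1}^n(2^j-1)},$$ where the series converges absolutely for every $\xi>0$ and the remainder $\widetilde G$ satisfies the bounds below. For every $\beta\in(0,\frac12)$ there is a constant $C_0>0$, depending only on $\beta$, such that the following estimates hold. For all $\xi>0$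 and all $\xi_2>\xi_1>0$, $$|Q(\xi)|\le C_0e^{-\xi},\qquad |e^{\xi_1}Q(\xi_1)-e^{\xi_2}Q(\xi_2)|\le C_0e^{-\xi_1}|\xi_1-\xi_2|;$$ for all $x>\xi>0$, respectively all $x>\xi_2>\xi_1>0$, $$|\widetilde G(x,\xi)|\le C_0e^{(1-\beta)(x-\xi)},\qquad |\widetilde G(x,\xi_1)-\widetilde G(x,\xi_2)|\le C_0|\xi_1-\xi_2|e^{(1-\beta)(x-\xi_1)};$$ and for all $x_2>x_1>\xi>0$, $$|\widetilde G(x_1,\xi)-\widetilde G(x_2,\xi)|\le C_0|x_1-x_2|e^{(1-\beta)(x_2-\xi)}.$$ -/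

import Mathlib

open Set Filter Topology MeasureTheory
open scoped ContDiff

namespace DelayEq

/-- The term of index `n` of the alternating series,
`(-1)^n 2^(2n) exp (-2^n ξ) / ∏_{j=1}^n (2^j - 1)`. -/
noncomputable def QTerm (n : ℕ) (ξ : ℝ) : ℝ :=
  (-1) ^ n * 2 ^ (2 * n) * Real.exp (-(2 ^ n * ξ)) / ∏ j ∈ Finset.Icc 1 n, ((2 : ℝ) ^ j - 1)

/-- `Q(ξ) = exp (-ξ) + ∑_{n ≥ 1} (-1)^n 2^(2n) exp (-2^n ξ) / ∏_{j=1}^n (2^j - 1)`. -/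
noncomputable def Q (ξ : ℝ) : ℝ :=
  Real.exp (-ξ) + ∑' n : ℕ, QTerm (n + 1) ξ

/-- `φ` solves `φ'(x) = φ(x) - 2 φ(x/2) + δ(x - ξ)` on `(0, ∞)` with `φ(0) = 0`:
`φ` is locally integrable on the open half-line, the equation holds in the sense of distributions
there, and the initial value is attained continuously. Values of `φ` at negative arguments
play no role. -/
structure IsSolution (ξ : ℝ) (φ : ℝ → ℝ) : Prop where
  locallyIntegrableOn : LocallyIntegrableOn φ (Ioi 0) volume
  equation : ∀ ψ : ℝ → ℝ, ContDiff ℝ ∞ ψ → HasCompactSupport ψ → tsupport ψ ⊆ Ioi 0 →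
    -∫ x in Ioi (0 : ℝ), φ x * deriv ψ x =
      (∫ x in Ioi (0 : ℝ), (φ x - 2 * φ (x / 2)) * ψ x) + ψ ξ
  map_zero : φ 0 = 0
  continuousWithinAt_zero : ContinuousWithinAt φ (Ici 0) 0

end DelayEq

/-!
Write `G(x, ξ) = exp (x - ξ) U(x, ξ)`. The delay equation with source at `ξ` becomes the integral
equation

  `U(x) = 1_{x > ξ} - 4 ∫_0^{x/2} exp (-z) U(z) dz`,

in which the value at `x` depends only on values up to `x / 2`, with an integrable weight. Hence
Picard iteration stabilizes on bounded sets and yields the solution (`normSol_eq`). The majorant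
`exp (4 * (1 - exp (-x)))` is reproduced by the integral operator (`add_integral_half_le`), so
`|U| ≤ exp 4` uniformly; by induction over dyadic intervals it also gives a Grönwall inequality
(`abs_le_of_le_add_integral_half`) and from it a Lipschitz bound in `ξ`
(`abs_normSol_sub_normSol_le`).

The limit of `U` at infinity is `L(ξ) = 1 - 4 ∫_0^∞ exp (-z) U(z) dz`, and the remainder
`G - exp x * exp (-ξ) * L(ξ) = 4 exp (x - ξ) ∫_{x/2}^∞ exp (-z) U(z) dz` for `x > ξ` is of order
`exp (x / 2 - ξ)`; the latter is at most `exp ((1 - β) (x - ξ))` because `β < 1 / 2` and `ξ > 0`.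
All estimates, including those on `Q`, are read off these two integral formulas.
That `exp (-ξ) * L(ξ)` equals the series `Q(ξ)` follows from the Laplace
transform of the integral equation, which expresses the transform at `a` by the transform
at `2 a + 1` (`laplace_normSol`). Starting at `a = 1` one visits `a = 2 ^ n - 1`, and the terms
picked up on the way are those of `Q`.

For a general `φ`, testing the equation against `ψ` amounts to testing the defect of the integral
equation against the derivative of `exp x * ψ x` (`integral_weakDefect_mul_deriv`). So `G` is a
distributional solution, and by the du Bois-Reymond lemma the defect of any solution is almost
everywhere constant; the initial condition makes the constant `0`. The difference of two
solutions then agrees almost everywhere with a continuous solution of the homogeneous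
integral equation, which vanishes (`eq_zero_of_homogeneous`).
-/

namespace DelayEq

/-! ### The integral equation: Grönwall's inequality and Picard iteration -/

theorem intervalIntegrable_exp_neg_mul {v : ℝ → ℝ} {C : ℝ} (hm : Measurable v)
    (hb : ∀ x, |v x| ≤ C) (a b : ℝ) :
    IntervalIntegrable (fun z => Real.exp (-z) * v z) volume a b := by
  have h : IntervalIntegrable (fun z : ℝ => Real.exp (-z)) volume a b :=
    (by fun_prop : Continuous fun z : ℝ => Real.exp (-z)).intervalIntegrable a b
  rw [intervalIntegrable_iff] at h ⊢
  exact h.mul_bdd hm.aestronglyMeasurable (ae_of_all _ hb)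

theorem integral_exp_neg_mul_exp (y : ℝ) :
    ∫ z in (0 : ℝ)..y, Real.exp (-z) * Real.exp (4 * (1 - Real.exp (-z))) =
      (Real.exp (4 * (1 - Real.exp (-y))) - 1) / 4 := by
  have hd : ∀ z ∈ uIcc 0 y, HasDerivAt (fun z : ℝ => Real.exp (4 * (1 - Real.exp (-z))) / 4)
      (Real.exp (-z) * Real.exp (4 * (1 - Real.exp (-z)))) z := by
    intro z _
    have h1 : HasDerivAt (fun z : ℝ => Real.exp (-z)) (-Real.exp (-z)) z := by
      simpa using (hasDerivAt_neg z).exp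
    have h2 := (((h1.const_sub 1).const_mul 4).exp).div_const 4
    refine h2.congr_deriv ?_
    ring
  rw [intervalIntegral.integral_eq_sub_of_hasDerivAt hd
    ((by fun_prop : Continuous fun z : ℝ =>
      Real.exp (-z) * Real.exp (4 * (1 - Real.exp (-z)))).intervalIntegrable _ _)]
  simp
  ring

/-- Inductive step of the delayed Grönwall inequality: a bound by the majorant
`a * exp (4 * (1 - exp (-z)))` on `[0, x / 2]` reproduces itself at `x`. -/
theorem add_integral_half_le {g : ℝ → ℝ} {a x : ℝ} (ha : 0 ≤ a) (hx : 0 ≤ x)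
    (hint : IntervalIntegrable (fun z => Real.exp (-z) * |g z|) volume 0 (x / 2))
    (hg : ∀ z, 0 ≤ z → z ≤ x / 2 → |g z| ≤ a * Real.exp (4 * (1 - Real.exp (-z)))) :
    a + 4 * ∫ z in (0 : ℝ)..x / 2, Real.exp (-z) * |g z| ≤
      a * Real.exp (4 * (1 - Real.exp (-x))) := by
  have h1 : ∫ z in (0 : ℝ)..x / 2, Real.exp (-z) * |g z| ≤
      ∫ z in (0 : ℝ)..x / 2, a * (Real.exp (-z) * Real.exp (4 * (1 - Real.exp (-z)))) := by
    refine intervalIntegral.integral_mono_on (by positivity) hint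
      ((by fun_prop : Continuous fun z : ℝ =>
        a * (Real.exp (-z) * Real.exp (4 * (1 - Real.exp (-z))))).intervalIntegrable _ _) ?_
    intro z hz
    calc Real.exp (-z) * |g z|
        ≤ Real.exp (-z) * (a * Real.exp (4 * (1 - Real.exp (-z)))) := by
          gcongr
          exact hg z hz.1 hz.2
      _ = _ := by ring
  rw [intervalIntegral.integral_const_mul, integral_exp_neg_mul_exp] at h1
  have h2 : Real.exp (4 * (1 - Real.exp (-(x / 2)))) ≤ Real.exp (4 * (1 - Real.exp (-x))) := by
    gcongr
    linarith
  nlinarith [mul_le_mul_of_nonneg_left h2 ha]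

/-- Grönwall's inequality for the halved delay. The weight `exp (-z)` has finite integral, so the
bound is uniform on the half-line; since the value at `x` involves only `[0, x / 2]`, induction over
the dyadic intervals `[0, 2 ^ n * η)` replaces the usual differentiation. -/
theorem abs_le_of_le_add_integral_half {f : ℝ → ℝ} {a η : ℝ} (hη : 0 < η) (ha : 0 ≤ a)
    (hint : ∀ y, 0 ≤ y → IntervalIntegrable (fun z => Real.exp (-z) * |f z|) volume 0 y)
    (h0 : ∀ x, 0 ≤ x → x < η → |f x| ≤ a)
    (hf : ∀ x, η ≤ x → |f x| ≤ a + 4 * ∫ z in (0 : ℝ)..x / 2, Real.exp (-z) * |f z|)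
    {x : ℝ} (hx : 0 ≤ x) : |f x| ≤ a * Real.exp 4 := by
  have hlow : ∀ x, 0 ≤ x → x < η → |f x| ≤ a * Real.exp (4 * (1 - Real.exp (-x))) := by
    intro x hx hxη
    refine (h0 x hx hxη).trans (le_mul_of_one_le_right ha (Real.one_le_exp ?_))
    have : Real.exp (-x) ≤ 1 := Real.exp_le_one_iff.2 (by linarith)
    linarith
  have key : ∀ n : ℕ, ∀ x, 0 ≤ x → x < 2 ^ n * η →
      |f x| ≤ a * Real.exp (4 * (1 - Real.exp (-x))) := by
    intro n
    induction n with
    | zero => intro x hx hxη; exact hlow x hx (by simpa using hxη)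
    | succ n ih =>
      intro x hx hxn
      rcases lt_or_ge x η with h | h
      · exact hlow x hx h
      · refine (hf x h).trans (add_integral_half_le ha hx (hint _ (by positivity)) ?_)
        intro z hz hzx
        refine ih z hz ?_
        rw [pow_succ] at hxn
        linarith
  obtain ⟨n, hn⟩ := pow_unbounded_of_one_lt (x / η) (one_lt_two : (1 : ℝ) < 2)
  refine (key n x hx ((div_lt_iff₀ hη).1 hn)).trans ?_
  gcongr
  have := Real.exp_pos (-x)
  linarith

/-- The Picard map of the integral equation for `U(x) = exp (ξ - x) * G(x, ξ)`:
`v ↦ 1_{x > ξ} - 4 ∫_0^{x/2} exp (-z) v(z) dz`. -/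
noncomputable def picardMap (ξ : ℝ) (v : ℝ → ℝ) (x : ℝ) : ℝ :=
  (Ioi ξ).indicator 1 x - 4 * ∫ z in (0 : ℝ)..x / 2, Real.exp (-z) * v z

/-- Picard iterates started at `0`. -/
noncomputable def picardIter (ξ : ℝ) : ℕ → ℝ → ℝ
  | 0 => 0
  | n + 1 => picardMap ξ (picardIter ξ n)

/-- The normalized fundamental solution `U(x, ξ) = exp (ξ - x) * G(x, ξ)`. The Picard iterates
stabilize on `(-∞, 2 ^ n * ξ]` from index `n` on, and `n = ⌈x / ξ⌉₊` satisfies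
`x ≤ 2 ^ n * ξ`. -/
noncomputable def normSol (ξ x : ℝ) : ℝ := picardIter ξ ⌈x / ξ⌉₊ x

theorem picardMap_eq_zero {ξ x : ℝ} {v : ℝ → ℝ} (hξ : 0 < ξ) (hv : ∀ x ≤ ξ, v x = 0)
    (hx : x ≤ ξ) : picardMap ξ v x = 0 := by
  have h : ∫ z in (0 : ℝ)..x / 2, Real.exp (-z) * v z = ∫ z in (0 : ℝ)..x / 2, (0 : ℝ) := by
    refine intervalIntegral.integral_congr fun z hz => ?_
    have : z ≤ ξ := hz.2.trans (max_le hξ.le (by linarith))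
    simp [hv z this]
  simp [picardMap, h, hx]

theorem picardIter_eq_zero {ξ : ℝ} (hξ : 0 < ξ) (n : ℕ) : ∀ x ≤ ξ, picardIter ξ n x = 0 := by
  induction n with
  | zero => intro x _; rfl
  | succ n ih => intro x hx; exact picardMap_eq_zero hξ ih hx

theorem measurable_picardMap {ξ C : ℝ} {v : ℝ → ℝ} (hm : Measurable v) (hb : ∀ x, |v x| ≤ C) :
    Measurable (picardMap ξ v) := by
  have h := intervalIntegral.continuous_primitive (intervalIntegrable_exp_neg_mul hm hb) 0
  have h2 : Continuous fun x : ℝ => ∫ z in (0 : ℝ)..x / 2, Real.exp (-z) * v z :=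
    h.comp (continuous_id.div_const 2)
  exact (measurable_one.indicator measurableSet_Ioi).sub (h2.measurable.const_mul 4)

theorem abs_integral_exp_neg_mul_le {v : ℝ → ℝ} {x : ℝ} (hx : 0 ≤ x) :
    |∫ z in (0 : ℝ)..x, Real.exp (-z) * v z| ≤ ∫ z in (0 : ℝ)..x, Real.exp (-z) * |v z| := by
  refine (intervalIntegral.abs_integral_le_integral_abs hx).trans_eq ?_
  simp [abs_mul]

theorem picardIter_measurable_and_bound {ξ : ℝ} (hξ : 0 < ξ) (n : ℕ) :
    Measurable (picardIter ξ n) ∧ (∀ x, |picardIter ξ n x| ≤ Real.exp 4) ∧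
      ∀ x, 0 ≤ x → |picardIter ξ n x| ≤ 1 * Real.exp (4 * (1 - Real.exp (-x))) := by
  induction n with
  | zero => exact ⟨measurable_zero, fun x => by simp [picardIter, Real.exp_nonneg],
      fun x _ => by simp [picardIter, Real.exp_nonneg]⟩
  | succ n ih =>
    obtain ⟨hm, hb, hr⟩ := ih
    have hr' : ∀ x, 0 ≤ x →
        |picardIter ξ (n + 1) x| ≤ 1 * Real.exp (4 * (1 - Real.exp (-x))) := by
      intro x hx
      refine le_trans ?_ (add_integral_half_le (g := picardIter ξ n) zero_le_one hx
        (intervalIntegrable_exp_neg_mul hm.abs (by simpa using hb) _ _) fun z hz _ => hr z hz)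
      refine (abs_sub _ _).trans (add_le_add ?_ ?_)
      · by_cases h : x ∈ Ioi ξ <;> simp [h]
      · rw [abs_mul, abs_of_pos (by norm_num : (0 : ℝ) < 4)]
        gcongr
        exact abs_integral_exp_neg_mul_le (by positivity)
    refine ⟨measurable_picardMap hm hb, fun x => ?_, hr'⟩
    rcases le_total x 0 with hx | hx
    · rw [picardIter_eq_zero hξ _ x (hx.trans hξ.le)]
      simp [Real.exp_nonneg]
    · refine (hr' x hx).trans ?_
      rw [one_mul]
      gcongr
      have := Real.exp_pos (-x)
      linarith

theorem picardIter_succ_eq {ξ : ℝ} (hξ : 0 < ξ) (n : ℕ) :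
    ∀ x ≤ 2 ^ n * ξ, picardIter ξ (n + 1) x = picardIter ξ n x := by
  induction n with
  | zero =>
    intro x hx
    rw [pow_zero, one_mul] at hx
    rw [picardIter_eq_zero hξ _ x hx, picardIter_eq_zero hξ _ x hx]
  | succ n ih =>
    intro x hx
    have : ∫ z in (0 : ℝ)..x / 2, Real.exp (-z) * picardIter ξ (n + 1) z =
        ∫ z in (0 : ℝ)..x / 2, Real.exp (-z) * picardIter ξ n z := by
      refine intervalIntegral.integral_congr fun z hz => ?_
      have hz' : z ≤ 2 ^ n * ξ := by
        refine hz.2.trans (max_le (by positivity) ?_)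
        rw [pow_succ] at hx
        linarith
      simp only [ih z hz']
    change picardMap ξ (picardIter ξ (n + 1)) x = picardMap ξ (picardIter ξ n) x
    simp only [picardMap, this]

theorem picardIter_eq_of_le {ξ x : ℝ} (hξ : 0 < ξ) {n m : ℕ} (hnm : n ≤ m)
    (hx : x ≤ 2 ^ n * ξ) : picardIter ξ m x = picardIter ξ n x := by
  induction m, hnm using Nat.le_induction with
  | base => rfl
  | succ m hm ih =>
    rw [picardIter_succ_eq hξ m x, ih]
    refine hx.trans ?_
    gcongr
    norm_num

theorem normSol_eq_picardIter {ξ x : ℝ} (hξ : 0 < ξ) {n : ℕ} (hn : ⌈x / ξ⌉₊ ≤ n) :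
    normSol ξ x = picardIter ξ n x := by
  refine (picardIter_eq_of_le hξ hn ?_).symm
  rw [← div_le_iff₀ hξ]
  refine (Nat.le_ceil _).trans ?_
  exact_mod_cast (Nat.lt_two_pow_self (n := ⌈x / ξ⌉₊)).le

theorem abs_normSol_le {ξ : ℝ} (hξ : 0 < ξ) (x : ℝ) : |normSol ξ x| ≤ Real.exp 4 :=
  (picardIter_measurable_and_bound hξ _).2.1 x

theorem normSol_eq_zero {ξ x : ℝ} (hξ : 0 < ξ) (hx : x ≤ ξ) : normSol ξ x = 0 :=
  picardIter_eq_zero hξ _ x hx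

theorem measurable_normSol {ξ : ℝ} (hξ : 0 < ξ) : Measurable (normSol ξ) := by
  refine measurable_of_tendsto_metrizable
    (fun n => (picardIter_measurable_and_bound hξ n).1) (tendsto_pi_nhds.2 fun x => ?_)
  refine tendsto_const_nhds.congr' ?_
  filter_upwards [eventually_ge_atTop ⌈x / ξ⌉₊] with n hn
  exact normSol_eq_picardIter hξ hn

theorem normSol_eq {ξ : ℝ} (hξ : 0 < ξ) (x : ℝ) :
    normSol ξ x = (Ioi ξ).indicator 1 x -
      4 * ∫ z in (0 : ℝ)..x / 2, Real.exp (-z) * normSol ξ z := by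
  rcases le_total x 0 with hx | hx
  · rw [normSol_eq_zero hξ (hx.trans hξ.le)]
    exact (picardMap_eq_zero hξ (fun _ => normSol_eq_zero hξ) (hx.trans hξ.le)).symm
  · have : ∫ z in (0 : ℝ)..x / 2, Real.exp (-z) * normSol ξ z =
        ∫ z in (0 : ℝ)..x / 2, Real.exp (-z) * picardIter ξ ⌈x / ξ⌉₊ z := by
      refine intervalIntegral.integral_congr fun z hz => ?_
      have hzx : z ≤ x := hz.2.trans (max_le hx (by linarith))
      simp only [normSol_eq_picardIter hξ (Nat.ceil_mono (div_le_div_of_nonneg_right hzx hξ.le))]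
    rw [normSol_eq_picardIter hξ (Nat.le_succ _), this]
    rfl

/-! ### The limit at infinity and the series -/

/-- Fubini's theorem for a primitive evaluated at `x / 2`. It computes the Laplace transform of the
delay term, and it serves as integration by parts when the primitive is not differentiable. -/
theorem integral_mul_integral_half {k b : ℝ → ℝ} (hk : IntegrableOn k (Ioi 0))
    (hb : IntegrableOn b (Ioi 0)) :
    ∫ x in Ioi (0 : ℝ), k x * ∫ y in (0 : ℝ)..x / 2, b y =
      ∫ y in Ioi (0 : ℝ), b y * ∫ x in Ioi (2 * y), k x := by
  set S : Set (ℝ × ℝ) := {p | 2 * p.2 ≤ p.1} with hS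
  have hSm : MeasurableSet S := measurableSet_le (by fun_prop) (by fun_prop)
  have hint : Integrable (Function.uncurry fun x y => S.indicator (fun p => k p.1 * b p.2) (x, y))
      ((volume.restrict (Ioi (0 : ℝ))).prod (volume.restrict (Ioi (0 : ℝ)))) :=
    (Integrable.mul_prod hk hb).indicator hSm
  have h := integral_integral_swap hint
  calc ∫ x in Ioi (0 : ℝ), k x * ∫ y in (0 : ℝ)..x / 2, b y
      = ∫ x in Ioi (0 : ℝ), ∫ y in Ioi (0 : ℝ), S.indicator (fun p => k p.1 * b p.2) (x, y) := by
        refine setIntegral_congr_fun measurableSet_Ioi fun x hx => ?_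
        have hx0 : (0 : ℝ) ≤ x / 2 := by have := mem_Ioi.1 hx; positivity
        have h1 : (fun y => S.indicator (fun p => k p.1 * b p.2) (x, y)) =
            (Iic (x / 2)).indicator fun y => k x * b y := by
          ext y
          have : (x, y) ∈ S ↔ y ∈ Iic (x / 2) := by
            simp only [hS, mem_ofPred_eq, mem_Iic]
            constructor <;> intro h <;> linarith
          by_cases hy : y ∈ Iic (x / 2)
          · rw [indicator_of_mem hy, indicator_of_mem (this.2 hy)]
          · rw [indicator_of_notMem hy, indicator_of_notMem (this.not.2 hy)]
        simp only [h1]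
        rw [setIntegral_indicator measurableSet_Iic, Ioi_inter_Iic, integral_const_mul,
          intervalIntegral.integral_of_le hx0]
    _ = ∫ y in Ioi (0 : ℝ), ∫ x in Ioi (0 : ℝ), S.indicator (fun p => k p.1 * b p.2) (x, y) := h
    _ = _ := by
        refine setIntegral_congr_fun measurableSet_Ioi fun y hy => ?_
        have hy0 : (0 : ℝ) < 2 * y := by have := mem_Ioi.1 hy; positivity
        have h1 : (fun x => S.indicator (fun p => k p.1 * b p.2) (x, y)) =
            (Ici (2 * y)).indicator fun x => b y * k x := by
          ext x
          have : (x, y) ∈ S ↔ x ∈ Ici (2 * y) := Iff.rfl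
          by_cases hx : x ∈ Ici (2 * y)
          · rw [indicator_of_mem hx, indicator_of_mem (this.2 hx), mul_comm]
          · rw [indicator_of_notMem hx, indicator_of_notMem (this.not.2 hx)]
        simp only [h1]
        have h2 : Ioi (0 : ℝ) ∩ Ici (2 * y) = Ici (2 * y) :=
          inter_eq_right.2 fun z hz => hy0.trans_le hz
        rw [setIntegral_indicator measurableSet_Ici, h2, integral_Ici_eq_integral_Ioi,
          integral_const_mul]

theorem integrableOn_exp_neg_mul {a : ℝ} (ha : 0 < a) (c : ℝ) :
    IntegrableOn (fun z => Real.exp (-(a * z))) (Ioi c) := by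
  simpa only [neg_mul] using integrableOn_exp_mul_Ioi (neg_lt_zero.2 ha) c

theorem integral_exp_neg_mul {a : ℝ} (ha : 0 < a) (c : ℝ) :
    ∫ z in Ioi c, Real.exp (-(a * z)) = Real.exp (-(a * c)) / a := by
  have := integral_exp_mul_Ioi (neg_lt_zero.2 ha) c
  simp only [neg_mul, neg_div_neg_eq] at this
  exact this

theorem integrableOn_exp_neg_mul_mul {v : ℝ → ℝ} {C a : ℝ} (ha : 0 < a) (hm : Measurable v)
    (hb : ∀ x, |v x| ≤ C) (c : ℝ) :
    IntegrableOn (fun z => Real.exp (-(a * z)) * v z) (Ioi c) :=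
  (integrableOn_exp_neg_mul ha c).mul_bdd hm.aestronglyMeasurable (ae_of_all _ hb)

theorem integrableOn_exp_neg_mul_bdd {v : ℝ → ℝ} {C : ℝ} (hm : Measurable v)
    (hb : ∀ x, |v x| ≤ C) (c : ℝ) :
    IntegrableOn (fun z => Real.exp (-z) * v z) (Ioi c) := by
  simpa only [one_mul] using integrableOn_exp_neg_mul_mul one_pos hm hb c

theorem abs_setIntegral_exp_neg_mul_le {v : ℝ → ℝ} {C : ℝ} (hb : ∀ x, |v x| ≤ C) (c : ℝ) :
    |∫ z in Ioi c, Real.exp (-z) * v z| ≤ C * Real.exp (-c) := by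
  have h := norm_integral_le_of_norm_le (μ := volume.restrict (Ioi c))
    (f := fun z => Real.exp (-z) * v z) (g := fun z => Real.exp (-z) * C)
    ((integrableOn_exp_neg_Ioi c).mul_const C) (ae_of_all _ fun z => by
      rw [Real.norm_eq_abs, abs_mul, Real.abs_exp]
      gcongr
      exact hb z)
  rwa [integral_mul_const, integral_exp_neg_Ioi, mul_comm] at h

/-- The limit of `U(x, ξ)` as `x → ∞`. -/
noncomputable def normLimit (ξ : ℝ) : ℝ := 1 - 4 * ∫ z in Ioi (0 : ℝ), Real.exp (-z) * normSol ξ z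

theorem normSol_sub_normLimit {ξ x : ℝ} (hξ : 0 < ξ) (hx : ξ < x) :
    normSol ξ x - normLimit ξ = 4 * ∫ z in Ioi (x / 2), Real.exp (-z) * normSol ξ z := by
  have hi := integrableOn_exp_neg_mul_bdd (measurable_normSol hξ) (abs_normSol_le hξ)
  have := intervalIntegral.integral_Ioi_sub_Ioi (hi 0) (by linarith : 0 ≤ x / 2)
  rw [normSol_eq hξ, normLimit, indicator_of_mem (mem_Ioi.2 hx), Pi.one_apply]
  linarith

/-- Laplace transform of the integral equation: the value at `a` is expressed by the value at
`2 * a + 1`. The orbit of `1` is `2 ^ n - 1`, the factors in the denominators of `Q`. -/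
theorem laplace_normSol {ξ a : ℝ} (hξ : 0 < ξ) (ha : 0 < a) :
    ∫ z in Ioi (0 : ℝ), Real.exp (-(a * z)) * normSol ξ z =
      (Real.exp (-(a * ξ)) -
        4 * ∫ z in Ioi (0 : ℝ), Real.exp (-((2 * a + 1) * z)) * normSol ξ z) / a := by
  have hU := integrableOn_exp_neg_mul_mul ha (measurable_normSol hξ) (abs_normSol_le hξ) 0
  have hI : IntegrableOn (fun z => Real.exp (-(a * z)) * (Ioi ξ).indicator 1 z) (Ioi 0) :=
    integrableOn_exp_neg_mul_mul ha (measurable_one.indicator measurableSet_Ioi) (C := 1)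
      (fun x => by by_cases h : x ∈ Ioi ξ <;> simp [h]) 0
  have h1 : ∫ z in Ioi (0 : ℝ), Real.exp (-(a * z)) * (Ioi ξ).indicator 1 z =
      Real.exp (-(a * ξ)) / a := by
    have h2 : (fun z => Real.exp (-(a * z)) * (Ioi ξ).indicator 1 z) =
        (Ioi ξ).indicator fun z => Real.exp (-(a * z)) := by
      ext z
      by_cases h : z ∈ Ioi ξ <;> simp [h]
    rw [h2, setIntegral_indicator measurableSet_Ioi, Ioi_inter_Ioi, max_eq_right hξ.le,
      integral_exp_neg_mul ha]
  have h3 := integral_mul_integral_half (integrableOn_exp_neg_mul ha 0)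
    (integrableOn_exp_neg_mul_bdd (measurable_normSol hξ) (abs_normSol_le hξ) 0)
  have h4 : ∫ x in Ioi (0 : ℝ), Real.exp (-(a * x)) *
      ∫ y in (0 : ℝ)..x / 2, Real.exp (-y) * normSol ξ y =
      (Real.exp (-(a * ξ)) / a - ∫ z in Ioi (0 : ℝ), Real.exp (-(a * z)) * normSol ξ z) / 4 := by
    rw [← h1, ← integral_sub hI hU, ← integral_div]
    refine integral_congr_ae (ae_of_all _ fun x => ?_)
    have := normSol_eq hξ x
    simp only
    rw [this]
    ring
  have h5 : ∫ y in Ioi (0 : ℝ), Real.exp (-y) * normSol ξ y *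
      ∫ x in Ioi (2 * y), Real.exp (-(a * x)) =
      (∫ z in Ioi (0 : ℝ), Real.exp (-((2 * a + 1) * z)) * normSol ξ z) / a := by
    rw [← integral_div]
    refine integral_congr_ae (ae_of_all _ fun y => ?_)
    simp only
    rw [integral_exp_neg_mul ha,
      show -((2 * a + 1) * y) = -y + -(a * (2 * y)) by ring, Real.exp_add]
    ring
  rw [h4, h5] at h3
  field_simp at h3 ⊢
  linarith

theorem QTerm_zero (ξ : ℝ) : QTerm 0 ξ = Real.exp (-ξ) := by simp [QTerm]

theorem two_pow_succ_sub_one_pos (n : ℕ) : (0 : ℝ) < 2 ^ (n + 1) - 1 :=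
  sub_pos.2 (one_lt_pow₀ one_lt_two n.succ_ne_zero)

theorem QTerm_succ (n : ℕ) (ξ : ℝ) :
    QTerm (n + 1) ξ = -4 / (2 ^ (n + 1) - 1) * Real.exp (-(2 ^ n * ξ)) * QTerm n ξ := by
  have h : Real.exp (-(2 ^ (n + 1) * ξ)) = Real.exp (-(2 ^ n * ξ)) * Real.exp (-(2 ^ n * ξ)) := by
    rw [← Real.exp_add]
    ring_nf
  rw [QTerm, QTerm, Finset.prod_Icc_succ_top (by simp), h, pow_succ (-1 : ℝ), mul_add, pow_add,
    div_mul_eq_mul_div, div_mul_eq_mul_div, mul_div_assoc', div_div]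
  ring_nf

theorem summable_QTerm {ξ : ℝ} (hξ : 0 ≤ ξ) : Summable fun n => QTerm n ξ := by
  refine summable_of_ratio_norm_eventually_le (r := 1 / 2) (by norm_num) ?_
  filter_upwards [eventually_ge_atTop 3] with n hn
  rw [QTerm_succ, norm_mul]
  gcongr
  have h16 : (2 : ℝ) ^ 4 ≤ 2 ^ (n + 1) := pow_le_pow_right₀ one_le_two (by omega)
  have hp := two_pow_succ_sub_one_pos n
  rw [norm_mul, norm_div, norm_neg, Real.norm_of_nonneg hp.le, Real.norm_of_nonneg (Real.exp_nonneg _),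
    Real.norm_of_nonneg (by norm_num : (0 : ℝ) ≤ 4)]
  have he : Real.exp (-(2 ^ n * ξ)) ≤ 1 := Real.exp_le_one_iff.2 (by
    have : (0 : ℝ) ≤ 2 ^ n * ξ := by positivity
    linarith)
  have hq : 4 / ((2 : ℝ) ^ (n + 1) - 1) ≤ 1 / 2 := by
    rw [div_le_div_iff₀ hp (by norm_num)]
    norm_num at h16
    linarith
  calc _ ≤ (1 / 2 : ℝ) * 1 := by gcongr
    _ = 1 / 2 := mul_one _

theorem QTerm_eq_QTerm_zero_mul (n : ℕ) (ξ : ℝ) :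
    QTerm n ξ = QTerm n 0 * Real.exp (-(2 ^ n * ξ)) := by
  simp [QTerm]
  ring

/-- Iterating `laplace_normSol` expands the limit of `U` into a partial sum of `Q` and a
remainder. -/
theorem exp_neg_mul_normLimit_eq_sum {ξ : ℝ} (hξ : 0 < ξ) (N : ℕ) :
    Real.exp (-ξ) * normLimit ξ = ∑ n ∈ Finset.range (N + 1), QTerm n ξ -
      4 * QTerm N 0 * Real.exp (-ξ) *
        ∫ z in Ioi (0 : ℝ), Real.exp (-((2 ^ (N + 1) - 1) * z)) * normSol ξ z := by
  induction N with
  | zero =>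
    rw [normLimit, zero_add, Finset.sum_range_one, QTerm_zero, QTerm_zero]
    norm_num
    ring
  | succ N ih =>
    have hp := two_pow_succ_sub_one_pos N
    rw [ih, Finset.sum_range_succ _ (N + 1), laplace_normSol hξ hp,
      show 2 * ((2 : ℝ) ^ (N + 1) - 1) + 1 = 2 ^ (N + 1 + 1) - 1 by ring,
      QTerm_eq_QTerm_zero_mul (N + 1) ξ, QTerm_succ N 0,
      show -(2 ^ (N + 1) * ξ) = -ξ + -((2 ^ (N + 1) - 1) * ξ) by ring, Real.exp_add]
    simp only [mul_zero, neg_zero, Real.exp_zero]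
    field_simp
    ring

theorem exp_neg_mul_normLimit {ξ : ℝ} (hξ : 0 < ξ) : Real.exp (-ξ) * normLimit ξ = Q ξ := by
  have hs := summable_QTerm hξ.le
  have hQ : Q ξ = ∑' n, QTerm n ξ := by
    rw [hs.tsum_eq_zero_add, QTerm_zero, Q]
  have h1 : Tendsto (fun N => ∑ n ∈ Finset.range (N + 1), QTerm n ξ) atTop (𝓝 (Q ξ)) := by
    rw [hQ]
    exact hs.hasSum.tendsto_sum_nat.comp (tendsto_add_atTop_nat 1)
  have hM : ∀ N : ℕ, |∫ z in Ioi (0 : ℝ), Real.exp (-((2 ^ (N + 1) - 1) * z)) * normSol ξ z| ≤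
      Real.exp 4 := by
    intro N
    have h := norm_integral_le_of_norm_le (μ := volume.restrict (Ioi (0 : ℝ)))
      (f := fun z => Real.exp (-((2 ^ (N + 1) - 1) * z)) * normSol ξ z)
      (g := fun z => Real.exp (-z) * Real.exp 4)
      ((integrableOn_exp_neg_Ioi 0).mul_const _) (by
        filter_upwards [ae_restrict_mem measurableSet_Ioi] with z hz
        rw [Real.norm_eq_abs, abs_mul, Real.abs_exp]
        have h2 : (2 : ℝ) ≤ 2 ^ (N + 1) := le_self_pow₀ one_le_two N.succ_ne_zero
        gcongr
        · have := mem_Ioi.1 hz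
          nlinarith
        · exact abs_normSol_le hξ z)
    rwa [integral_mul_const, integral_exp_neg_Ioi_zero, one_mul] at h
  have h2 : Tendsto (fun N : ℕ => 4 * QTerm N 0 * Real.exp (-ξ) *
      ∫ z in Ioi (0 : ℝ), Real.exp (-((2 ^ (N + 1) - 1) * z)) * normSol ξ z) atTop (𝓝 0) := by
    have h3 : Tendsto (fun N : ℕ => 4 * QTerm N 0 * Real.exp (-ξ)) atTop (𝓝 0) := by
      simpa using ((summable_QTerm le_rfl).tendsto_atTop_zero.const_mul 4).mul_const
        (Real.exp (-ξ))
    exact h3.zero_mul_isBoundedUnder_le (isBoundedUnder_of ⟨Real.exp 4, hM⟩)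
  have h4 := h1.sub h2
  rw [sub_zero] at h4
  exact tendsto_nhds_unique (tendsto_const_nhds.congr (exp_neg_mul_normLimit_eq_sum hξ)) h4

theorem abs_normLimit_le {ξ : ℝ} (hξ : 0 < ξ) : |normLimit ξ| ≤ 1 + 4 * Real.exp 4 := by
  have h := abs_setIntegral_exp_neg_mul_le (abs_normSol_le hξ) 0
  rw [neg_zero, Real.exp_zero, mul_one] at h
  refine (abs_sub _ _).trans ?_
  rw [abs_one, abs_mul, abs_of_pos (by norm_num : (0 : ℝ) < 4)]
  gcongr

/-! ### Estimates on the limit and the remainder -/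

/-- The remainder `G(x, ξ) - exp x * Q ξ` for `x > ξ`, written as `4 exp (x - ξ)` times the tail
integral of `exp (-z) U(z, ξ)` over `(x / 2, ∞)`. -/
noncomputable def remainder (x ξ : ℝ) : ℝ :=
  4 * Real.exp (x - ξ) * ∫ z in Ioi (x / 2), Real.exp (-z) * normSol ξ z

theorem exp_mul_normSol_eq {ξ x : ℝ} (hξ : 0 < ξ) (hx : ξ < x) :
    Real.exp (x - ξ) * normSol ξ x = Real.exp x * Q ξ + remainder x ξ := by
  have h := normSol_sub_normLimit hξ hx
  rw [← exp_neg_mul_normLimit hξ, remainder, mul_right_comm, ← h, sub_eq_add_neg, Real.exp_add]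
  ring

/-- Past both sources, `U` is Lipschitz in the position of the source, with a constant decaying in
that position: the two solutions differ by a bounded amount on `(ξ₁, ξ₂]` only, and Grönwall
propagates the integral of `exp (-z)` times this amount. -/
theorem abs_normSol_sub_normSol_le {ξ₁ ξ₂ z : ℝ} (h₁ : 0 < ξ₁) (h₂ : ξ₁ < ξ₂) (hz : ξ₂ < z) :
    |normSol ξ₁ z - normSol ξ₂ z| ≤
      4 * (Real.exp 4 * Real.exp (-ξ₁) * (ξ₂ - ξ₁)) * Real.exp 4 := by
  have h₂' := h₁.trans h₂
  set K := Real.exp 4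
  have hK : 0 < K := Real.exp_pos 4
  set D : ℝ → ℝ := fun z => normSol ξ₁ z - normSol ξ₂ z with hD
  have hDm : Measurable D := (measurable_normSol h₁).sub (measurable_normSol h₂')
  have hDb : ∀ z, |D z| ≤ K + K := fun z => (abs_sub _ _).trans
    (add_le_add (abs_normSol_le h₁ z) (abs_normSol_le h₂' z))
  set f : ℝ → ℝ := (Ioi ξ₂).indicator D with hf
  set g : ℝ → ℝ := (Ioc ξ₁ ξ₂).indicator fun _ => K * Real.exp (-ξ₁) with hg
  have hfm : Measurable f := hDm.indicator measurableSet_Ioi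
  have hfb : ∀ z, |f z| ≤ K + K := fun z => by
    by_cases h : z ∈ Ioi ξ₂
    · rw [hf, indicator_of_mem h]; exact hDb z
    · rw [hf, indicator_of_notMem h, abs_zero]; positivity
  have hfi : ∀ y, IntervalIntegrable (fun z => Real.exp (-z) * |f z|) volume 0 y := fun y =>
    intervalIntegrable_exp_neg_mul hfm.abs (by simpa using hfb) 0 y
  have hgI : Integrable g := (integrable_indicator_iff measurableSet_Ioc).2
    (integrableOn_const measure_Ioc_lt_top.ne)
  have hgint : ∀ y, 0 ≤ y → ∫ z in (0 : ℝ)..y, g z ≤ K * Real.exp (-ξ₁) * (ξ₂ - ξ₁) := by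
    intro y hy
    rw [intervalIntegral.integral_of_le hy]
    refine (setIntegral_le_integral hgI (ae_of_all _ fun z => ?_)).trans_eq ?_
    · exact indicator_nonneg (fun _ _ => by positivity) z
    · rw [hg, integral_indicator measurableSet_Ioc, setIntegral_const,
        Real.volume_real_Ioc_of_le h₂.le, smul_eq_mul, mul_comm]
  have hpt : ∀ z, Real.exp (-z) * |D z| ≤ Real.exp (-z) * |f z| + g z := by
    intro z
    rcases le_or_gt z ξ₁ with h | h
    · have h0 : D z = 0 := by
        simp only [hD, normSol_eq_zero h₁ h, normSol_eq_zero h₂' (h.trans h₂.le), sub_zero]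
      rw [h0, abs_zero, mul_zero]
      have : 0 ≤ g z := indicator_nonneg (fun _ _ => by positivity) z
      positivity
    · rcases le_or_gt z ξ₂ with h' | h'
      · have h0 : D z = normSol ξ₁ z := by
          simp only [hD, normSol_eq_zero h₂' h', sub_zero]
        have h3 : g z = K * Real.exp (-ξ₁) := indicator_of_mem (show z ∈ Ioc ξ₁ ξ₂ from ⟨h, h'⟩) _
        have h4 : Real.exp (-z) * |D z| ≤ Real.exp (-ξ₁) * K := by
          rw [h0]
          gcongr
          exact abs_normSol_le h₁ z
        have : 0 ≤ Real.exp (-z) * |f z| := by positivity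
        linarith
      · have h0 : f z = D z := indicator_of_mem (mem_Ioi.2 h') _
        have : 0 ≤ g z := indicator_nonneg (fun _ _ => by positivity) z
        rw [h0]
        linarith
  have key := abs_le_of_le_add_integral_half (f := f) (η := ξ₂)
    (a := 4 * (K * Real.exp (-ξ₁) * (ξ₂ - ξ₁))) h₂' (by
      have := sub_pos.2 h₂
      positivity) (fun y _ => hfi y)
    (fun x _ hx => by
      rw [hf, indicator_of_notMem (by simpa using hx.le), abs_zero]
      have := sub_pos.2 h₂
      positivity)
    (fun x hx => by
      have hx0 : 0 ≤ x / 2 := by linarith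
      have hle : |∫ z in (0 : ℝ)..x / 2, Real.exp (-z) * D z| ≤
          (∫ z in (0 : ℝ)..x / 2, Real.exp (-z) * |f z|) + K * Real.exp (-ξ₁) * (ξ₂ - ξ₁) := by
        refine (abs_integral_exp_neg_mul_le hx0).trans ?_
        refine le_trans ?_ (add_le_add_right (hgint (x / 2) hx0) _)
        rw [← intervalIntegral.integral_add (hfi _) hgI.intervalIntegrable]
        exact intervalIntegral.integral_mono_on hx0
          (intervalIntegrable_exp_neg_mul hDm.abs (by simpa using hDb) 0 _)
          ((hfi _).add hgI.intervalIntegrable) fun z _ => hpt z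
      rcases hx.eq_or_lt with rfl | hx'
      · rw [hf, indicator_of_notMem (by simp), abs_zero]
        have := (abs_nonneg _).trans hle
        linarith
      · rw [hf, indicator_of_mem (mem_Ioi.2 hx')]
        have hDx : D x = -(4 * ∫ z in (0 : ℝ)..x / 2, Real.exp (-z) * D z) := by
          have h1 := normSol_eq h₁ x
          have h2 := normSol_eq h₂' x
          rw [indicator_of_mem (mem_Ioi.2 (h₂.trans hx'))] at h1
          rw [indicator_of_mem (mem_Ioi.2 hx')] at h2
          have h3 : ∫ z in (0 : ℝ)..x / 2, Real.exp (-z) * D z =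
              (∫ z in (0 : ℝ)..x / 2, Real.exp (-z) * normSol ξ₁ z) -
                ∫ z in (0 : ℝ)..x / 2, Real.exp (-z) * normSol ξ₂ z := by
            rw [← intervalIntegral.integral_sub
              (intervalIntegrable_exp_neg_mul (measurable_normSol h₁) (abs_normSol_le h₁) _ _)
              (intervalIntegrable_exp_neg_mul (measurable_normSol h₂') (abs_normSol_le h₂') _ _)]
            simp only [hD, mul_sub]
          rw [h3]
          simp only [hD]
          linarith
        rw [hDx, abs_neg, abs_mul, abs_of_pos (by norm_num : (0 : ℝ) < 4)]
        linarith)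
    (h₂'.le.trans hz.le)
  rwa [hf, indicator_of_mem (mem_Ioi.2 hz)] at key

theorem abs_tail_sub_tail_le {ξ₁ ξ₂ y : ℝ} (h₁ : 0 < ξ₁) (h₂ : ξ₁ < ξ₂) :
    |(∫ z in Ioi y, Real.exp (-z) * normSol ξ₁ z) - ∫ z in Ioi y, Real.exp (-z) * normSol ξ₂ z| ≤
      (Real.exp 4 + 4 * Real.exp 4 ^ 2) * (ξ₂ - ξ₁) * Real.exp (-y) := by
  have h₂' := h₁.trans h₂
  set K := Real.exp 4
  have hK : 0 < K := Real.exp_pos 4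
  have hδ := sub_pos.2 h₂
  rw [← integral_sub
    (integrableOn_exp_neg_mul_bdd (measurable_normSol h₁) (abs_normSol_le h₁) y)
    (integrableOn_exp_neg_mul_bdd (measurable_normSol h₂') (abs_normSol_le h₂') y)]
  set g : ℝ → ℝ := (Ioc ξ₁ ξ₂).indicator fun _ => K * Real.exp (-y) with hg
  have hg0 : ∀ z, 0 ≤ g z := fun z => indicator_nonneg (fun _ _ => by positivity) z
  have hgI : Integrable g := (integrable_indicator_iff measurableSet_Ioc).2
    (integrableOn_const measure_Ioc_lt_top.ne)
  have hgint : ∫ z in Ioi y, g z ≤ K * Real.exp (-y) * (ξ₂ - ξ₁) := by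
    refine (setIntegral_le_integral hgI (ae_of_all _ hg0)).trans_eq ?_
    rw [hg, integral_indicator measurableSet_Ioc, setIntegral_const,
      Real.volume_real_Ioc_of_le h₂.le, smul_eq_mul, mul_comm]
  have hpt : ∀ z ∈ Ioi y, ‖Real.exp (-z) * normSol ξ₁ z - Real.exp (-z) * normSol ξ₂ z‖ ≤
      Real.exp (-z) * (4 * K ^ 2 * (ξ₂ - ξ₁)) + g z := by
    intro z hz
    have hzy : y ≤ z := (mem_Ioi.1 hz).le
    rw [← mul_sub, Real.norm_eq_abs, abs_mul, Real.abs_exp]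
    rcases le_or_gt z ξ₁ with h | h
    · rw [normSol_eq_zero h₁ h, normSol_eq_zero h₂' (h.trans h₂.le), sub_zero, abs_zero, mul_zero]
      have := hg0 z
      positivity
    · rcases le_or_gt z ξ₂ with h' | h'
      · have h3 : g z = K * Real.exp (-y) := indicator_of_mem (show z ∈ Ioc ξ₁ ξ₂ from ⟨h, h'⟩) _
        have h4 : Real.exp (-z) * |normSol ξ₁ z| ≤ Real.exp (-y) * K := by
          gcongr
          exact abs_normSol_le h₁ z
        have : 0 ≤ Real.exp (-z) * (4 * K ^ 2 * (ξ₂ - ξ₁)) := by positivity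
        rw [normSol_eq_zero h₂' h', sub_zero]
        linarith
      · have h4 : |normSol ξ₁ z - normSol ξ₂ z| ≤ 4 * K ^ 2 * (ξ₂ - ξ₁) := by
          refine (abs_normSol_sub_normSol_le h₁ h₂ h').trans ?_
          have he : Real.exp (-ξ₁) ≤ 1 := Real.exp_le_one_iff.2 (by linarith)
          calc 4 * (K * Real.exp (-ξ₁) * (ξ₂ - ξ₁)) * K ≤ 4 * (K * 1 * (ξ₂ - ξ₁)) * K := by gcongr
            _ = _ := by ring
        have := hg0 z
        have := mul_le_mul_of_nonneg_left h4 (Real.exp_nonneg (-z))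
        linarith
  have hexp : IntegrableOn (fun z => Real.exp (-z) * (4 * K ^ 2 * (ξ₂ - ξ₁))) (Ioi y) :=
    (integrableOn_exp_neg_Ioi y).mul_const _
  have h := norm_integral_le_of_norm_le (hexp.add hgI.integrableOn)
    ((ae_restrict_mem measurableSet_Ioi).mono hpt)
  refine h.trans ?_
  simp only [Pi.add_apply]
  rw [integral_add hexp hgI.integrableOn, integral_mul_const, integral_exp_neg_Ioi]
  linarith

/-- The tail estimate applied on `(ξ₁, ∞)`: the solutions with sources `ξ₁ < ξ₂` both vanish
up to `ξ₁`, hence the factor `exp (-ξ₁)`. -/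
theorem abs_normLimit_sub_normLimit_le {ξ₁ ξ₂ : ℝ} (h₁ : 0 < ξ₁) (h₂ : ξ₁ < ξ₂) :
    |normLimit ξ₁ - normLimit ξ₂| ≤
      4 * ((Real.exp 4 + 4 * Real.exp 4 ^ 2) * (ξ₂ - ξ₁) * Real.exp (-ξ₁)) := by
  have h : ∀ ξ, 0 < ξ → ξ₁ ≤ ξ → ∫ z in Ioi (0 : ℝ), Real.exp (-z) * normSol ξ z =
      ∫ z in Ioi ξ₁, Real.exp (-z) * normSol ξ z := by
    intro ξ hξ hle
    refine setIntegral_eq_of_subset_of_forall_sdiff_eq_zero measurableSet_Ioi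
      (Ioi_subset_Ioi h₁.le) fun z hz => ?_
    rw [normSol_eq_zero hξ ((not_lt.1 hz.2).trans hle), mul_zero]
  have h3 := abs_tail_sub_tail_le (y := ξ₁) h₁ h₂
  rw [normLimit, normLimit, h ξ₁ h₁ le_rfl, h ξ₂ (h₁.trans h₂) h₂.le, sub_sub_sub_cancel_left,
    ← mul_sub, abs_mul, abs_of_pos (by norm_num : (0 : ℝ) < 4), abs_sub_comm]
  gcongr

theorem abs_exp_mul_Q_sub_le {ξ₁ ξ₂ : ℝ} (h₁ : 0 < ξ₁) (h₂ : ξ₁ < ξ₂) :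
    |Real.exp ξ₁ * Q ξ₁ - Real.exp ξ₂ * Q ξ₂| ≤
      4 * (Real.exp 4 + 4 * Real.exp 4 ^ 2) * Real.exp (-ξ₁) * |ξ₁ - ξ₂| := by
  have h : ∀ ξ, 0 < ξ → Real.exp ξ * Q ξ = normLimit ξ := by
    intro ξ hξ
    rw [← exp_neg_mul_normLimit hξ, ← mul_assoc, ← Real.exp_add, add_neg_cancel, Real.exp_zero,
      one_mul]
  rw [h ξ₁ h₁, h ξ₂ (h₁.trans h₂), abs_of_neg (sub_neg.2 h₂), neg_sub]
  exact (abs_normLimit_sub_normLimit_le h₁ h₂).trans_eq (by ring)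

theorem abs_remainder_le {ξ x : ℝ} (hξ : 0 < ξ) :
    |remainder x ξ| ≤ 4 * Real.exp 4 * Real.exp (x / 2 - ξ) := by
  rw [remainder, abs_mul, abs_of_pos (by positivity)]
  calc 4 * Real.exp (x - ξ) * |∫ z in Ioi (x / 2), Real.exp (-z) * normSol ξ z|
      ≤ 4 * Real.exp (x - ξ) * (Real.exp 4 * Real.exp (-(x / 2))) := by
        gcongr
        exact abs_setIntegral_exp_neg_mul_le (abs_normSol_le hξ) _
    _ = 4 * Real.exp 4 * (Real.exp (x - ξ) * Real.exp (-(x / 2))) := by ring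
    _ = _ := by rw [← Real.exp_add]; ring_nf

theorem exp_sub_exp_le {a b : ℝ} : Real.exp b - Real.exp a ≤ Real.exp b * (b - a) := by
  have h1 := Real.add_one_le_exp (a - b)
  have h2 : Real.exp a = Real.exp b * Real.exp (a - b) := by rw [← Real.exp_add]; ring_nf
  rw [h2]
  nlinarith [Real.exp_pos b]

theorem abs_remainder_sub_source_le {ξ₁ ξ₂ x : ℝ} (h₁ : 0 < ξ₁) (h₂ : ξ₁ < ξ₂) :
    |remainder x ξ₁ - remainder x ξ₂| ≤
      (8 * Real.exp 4 + 16 * Real.exp 4 ^ 2) * (ξ₂ - ξ₁) * Real.exp (x / 2 - ξ₁) := by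
  have hR := abs_tail_sub_tail_le (y := x / 2) h₁ h₂
  have hR₂ := abs_setIntegral_exp_neg_mul_le (abs_normSol_le (h₁.trans h₂)) (x / 2)
  set R₁ := ∫ z in Ioi (x / 2), Real.exp (-z) * normSol ξ₁ z with hR₁def
  set R₂ := ∫ z in Ioi (x / 2), Real.exp (-z) * normSol ξ₂ z with hR₂def
  have hexp : |Real.exp (x - ξ₁) - Real.exp (x - ξ₂)| ≤ Real.exp (x - ξ₁) * (ξ₂ - ξ₁) := by
    rw [abs_of_nonneg (sub_nonneg.2 (Real.exp_le_exp.2 (by linarith)))]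
    refine exp_sub_exp_le.trans_eq ?_
    ring
  have hsplit : remainder x ξ₁ - remainder x ξ₂ =
      4 * (Real.exp (x - ξ₁) * (R₁ - R₂)) +
        4 * ((Real.exp (x - ξ₁) - Real.exp (x - ξ₂)) * R₂) := by
    rw [remainder, remainder]
    ring
  have hδ := sub_pos.2 h₂
  calc |remainder x ξ₁ - remainder x ξ₂|
      ≤ 4 * (Real.exp (x - ξ₁) * |R₁ - R₂|) +
        4 * (|Real.exp (x - ξ₁) - Real.exp (x - ξ₂)| * |R₂|) := by
        rw [hsplit]
        refine (abs_add_le _ _).trans_eq ?_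
        simp only [abs_mul, Real.abs_exp, abs_of_pos (by norm_num : (0 : ℝ) < 4)]
    _ ≤ 4 * (Real.exp (x - ξ₁) *
          ((Real.exp 4 + 4 * Real.exp 4 ^ 2) * (ξ₂ - ξ₁) * Real.exp (-(x / 2)))) +
        4 * (Real.exp (x - ξ₁) * (ξ₂ - ξ₁) * (Real.exp 4 * Real.exp (-(x / 2)))) := by gcongr
    _ = (8 * Real.exp 4 + 16 * Real.exp 4 ^ 2) * (ξ₂ - ξ₁) *
          (Real.exp (x - ξ₁) * Real.exp (-(x / 2))) := by ring
    _ = _ := by rw [← Real.exp_add]; ring_nf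

theorem abs_remainder_sub_le {ξ x₁ x₂ : ℝ} (hξ : 0 < ξ) (hx : x₁ < x₂) :
    |remainder x₁ ξ - remainder x₂ ξ| ≤
      6 * Real.exp 4 * (x₂ - x₁) * Real.exp (x₂ / 2 - ξ) := by
  have hR₂ := abs_setIntegral_exp_neg_mul_le (abs_normSol_le hξ) (x₂ / 2)
  have hi := integrableOn_exp_neg_mul_bdd (measurable_normSol hξ) (abs_normSol_le hξ)
  have hsub := intervalIntegral.integral_Ioi_sub_Ioi (hi (x₁ / 2))
    (by linarith : x₁ / 2 ≤ x₂ / 2)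
  have hR : |(∫ z in Ioi (x₁ / 2), Real.exp (-z) * normSol ξ z) -
      ∫ z in Ioi (x₂ / 2), Real.exp (-z) * normSol ξ z| ≤
        Real.exp (-(x₁ / 2)) * Real.exp 4 * ((x₂ - x₁) / 2) := by
    rw [hsub, ← Real.norm_eq_abs]
    refine (intervalIntegral.norm_integral_le_of_norm_le_const
      (C := Real.exp (-(x₁ / 2)) * Real.exp 4) fun z hz => ?_).trans_eq ?_
    · rw [uIoc_of_le (by linarith)] at hz
      rw [Real.norm_eq_abs, abs_mul, Real.abs_exp]
      have := hz.1.le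
      gcongr
      exact abs_normSol_le hξ z
    · rw [abs_of_pos (by linarith)]
      ring
  set R₁ := ∫ z in Ioi (x₁ / 2), Real.exp (-z) * normSol ξ z with hR₁def
  set R₂ := ∫ z in Ioi (x₂ / 2), Real.exp (-z) * normSol ξ z with hR₂def
  have hexp : |Real.exp (x₁ - ξ) - Real.exp (x₂ - ξ)| ≤ Real.exp (x₂ - ξ) * (x₂ - x₁) := by
    rw [abs_sub_comm, abs_of_nonneg (sub_nonneg.2 (Real.exp_le_exp.2 (by linarith)))]
    refine exp_sub_exp_le.trans_eq ?_
    ring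
  have hsplit : remainder x₁ ξ - remainder x₂ ξ =
      4 * (Real.exp (x₁ - ξ) * (R₁ - R₂)) +
        4 * ((Real.exp (x₁ - ξ) - Real.exp (x₂ - ξ)) * R₂) := by
    rw [remainder, remainder]
    ring
  have hδ := sub_pos.2 hx
  calc |remainder x₁ ξ - remainder x₂ ξ|
      ≤ 4 * (Real.exp (x₁ - ξ) * |R₁ - R₂|) +
        4 * (|Real.exp (x₁ - ξ) - Real.exp (x₂ - ξ)| * |R₂|) := by
        rw [hsplit]
        refine (abs_add_le _ _).trans_eq ?_
        simp only [abs_mul, Real.abs_exp, abs_of_pos (by norm_num : (0 : ℝ) < 4)]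
    _ ≤ 4 * (Real.exp (x₁ - ξ) * (Real.exp (-(x₁ / 2)) * Real.exp 4 * ((x₂ - x₁) / 2))) +
        4 * (Real.exp (x₂ - ξ) * (x₂ - x₁) * (Real.exp 4 * Real.exp (-(x₂ / 2)))) := by gcongr
    _ = 2 * Real.exp 4 * (x₂ - x₁) * (Real.exp (x₁ - ξ) * Real.exp (-(x₁ / 2))) +
        4 * Real.exp 4 * (x₂ - x₁) * (Real.exp (x₂ - ξ) * Real.exp (-(x₂ / 2))) := by ring
    _ = 2 * Real.exp 4 * (x₂ - x₁) * Real.exp (x₁ / 2 - ξ) +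
        4 * Real.exp 4 * (x₂ - x₁) * Real.exp (x₂ / 2 - ξ) := by
        rw [← Real.exp_add, ← Real.exp_add]; ring_nf
    _ ≤ 2 * Real.exp 4 * (x₂ - x₁) * Real.exp (x₂ / 2 - ξ) +
        4 * Real.exp 4 * (x₂ - x₁) * Real.exp (x₂ / 2 - ξ) := by gcongr
    _ = _ := by ring

/-! ### Primitives and distributional derivatives on the half-line -/

theorem integrableOn_mul_of_hasCompactSupport {f g : ℝ → ℝ}
    (hf : ∀ R, IntegrableOn f (Ioc 0 R)) (hg : Continuous g) (hs : HasCompactSupport g) :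
    IntegrableOn (fun x => f x * g x) (Ioi 0) := by
  obtain ⟨R, hR⟩ := hs.isCompact.bddAbove
  obtain ⟨C, hC⟩ := hg.bounded_above_of_compact_support hs
  have h : IntegrableOn (fun x => f x * g x) (Ioc 0 R) :=
    (hf R).mul_bdd hg.aestronglyMeasurable (ae_of_all _ hC)
  refine h.of_forall_sdiff_eq_zero measurableSet_Ioi fun x hx => ?_
  rw [image_eq_zero_of_notMem_tsupport (fun hx' => hx.2 ⟨hx.1, hR hx'⟩), mul_zero]

theorem continuousOn_primitive_half {g : ℝ → ℝ} (hg : ∀ R, IntegrableOn g (Ioc 0 R)) :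
    ContinuousOn (fun x => ∫ y in (0 : ℝ)..x / 2, g y) (Ici 0) := by
  have h : ContinuousOn (fun x => ∫ y in (0 : ℝ)..x, g y) (Ici 0) := by
    intro x hx
    have hx0 : (0 : ℝ) ≤ x + 1 := by have := mem_Ici.1 hx; linarith
    have h1 := intervalIntegral.continuousOn_primitive_interval (μ := volume) (f := g)
      (a := 0) (b := x + 1) (by
        rw [uIcc_of_le hx0, integrableOn_Icc_iff_integrableOn_Ioc]
        exact hg _)
    rw [uIcc_of_le hx0] at h1
    refine (h1 x ⟨hx, by linarith⟩).mono_of_mem_nhdsWithin ?_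
    rw [← Ici_inter_Iic]
    exact inter_mem self_mem_nhdsWithin (mem_nhdsWithin_of_mem_nhds (Iic_mem_nhds (by linarith)))
  refine h.comp (continuous_id.div_const 2).continuousOn fun x hx => ?_
  have := mem_Ici.1 hx
  exact mem_Ici.2 (div_nonneg this zero_le_two)

theorem integrableOn_Ioc_of_continuousOn {g : ℝ → ℝ} (hg : ContinuousOn g (Ici 0)) (R : ℝ) :
    IntegrableOn g (Ioc 0 R) :=
  ((hg.mono Icc_subset_Ici_self).integrableOn_Icc).mono_set Ioc_subset_Icc_self

/-- Integration by parts against a primitive evaluated at `x / 2`. -/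
theorem integral_deriv_mul_primitive_half {g θ : ℝ → ℝ} (hg : ∀ R, IntegrableOn g (Ioc 0 R))
    (hθ : ContDiff ℝ ∞ θ) (hs : HasCompactSupport θ) :
    ∫ x in Ioi (0 : ℝ), (∫ y in (0 : ℝ)..x / 2, g y) * deriv θ x =
      -∫ y in Ioi (0 : ℝ), g y * θ (2 * y) := by
  obtain ⟨R, hR⟩ := hs.isCompact.bddAbove
  have hθ1 : ContDiff ℝ 1 θ := hθ.of_le (by exact_mod_cast le_top)
  have hθ0 : ∀ x, R < x → θ x = 0 := fun x hx =>
    image_eq_zero_of_notMem_tsupport fun h => absurd (hR h) hx.not_ge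
  have hθ' : ∀ x, R < x → deriv θ x = 0 := fun x hx => by
    by_contra h
    exact absurd (hR (support_deriv_subset h)) hx.not_ge
  have hk : IntegrableOn (deriv θ) (Ioi 0) :=
    ((hθ1.continuous_deriv le_rfl).integrable_of_hasCompactSupport hs.deriv).integrableOn
  -- Fubini needs an integrable factor; the support of `θ` allows to cut `g` off beyond `R`.
  have hb : IntegrableOn ((Ioc 0 R).indicator g) (Ioi 0) :=
    ((integrable_indicator_iff measurableSet_Ioc).2 (hg R)).integrableOn
  have h := integral_mul_integral_half hk hb
  have h1 : ∫ x in Ioi (0 : ℝ), deriv θ x * ∫ y in (0 : ℝ)..x / 2, (Ioc 0 R).indicator g y =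
      ∫ x in Ioi (0 : ℝ), (∫ y in (0 : ℝ)..x / 2, g y) * deriv θ x := by
    refine setIntegral_congr_fun measurableSet_Ioi fun x hx => ?_
    have hx0 := mem_Ioi.1 hx
    rcases lt_or_ge R x with hxR | hxR
    · simp only [hθ' x hxR, zero_mul, mul_zero]
    · rw [mul_comm]
      congr 1
      rw [intervalIntegral.integral_of_le (by positivity),
        intervalIntegral.integral_of_le (by positivity)]
      refine setIntegral_congr_fun measurableSet_Ioc fun y hy => ?_
      exact indicator_of_mem (show y ∈ Ioc 0 R from ⟨hy.1, by linarith [hy.2]⟩) g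
  have h2 : ∫ y in Ioi (0 : ℝ), (Ioc 0 R).indicator g y * ∫ x in Ioi (2 * y), deriv θ x =
      -∫ y in Ioi (0 : ℝ), g y * θ (2 * y) := by
    rw [← integral_neg]
    refine setIntegral_congr_fun measurableSet_Ioi fun y hy => ?_
    have hy0 := mem_Ioi.1 hy
    rw [hs.integral_Ioi_deriv_eq hθ1]
    by_cases hyR : y ≤ R
    · rw [indicator_of_mem (show y ∈ Ioc 0 R from ⟨hy, hyR⟩)]
      ring
    · rw [hθ0 (2 * y) (by linarith)]
      ring
  rw [← h1, h, h2]

/-- The du Bois-Reymond lemma on the half-line: a function whose distributional derivative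
vanishes is almost everywhere constant. -/
theorem ae_eq_const_of_integral_mul_deriv_eq_zero {F : ℝ → ℝ}
    (hF : ∀ R, IntegrableOn F (Ioc 0 R))
    (h : ∀ θ : ℝ → ℝ, ContDiff ℝ ∞ θ → HasCompactSupport θ → tsupport θ ⊆ Ioi 0 →
      ∫ x in Ioi (0 : ℝ), F x * deriv θ x = 0) :
    ∃ c, ∀ᵐ x ∂(volume.restrict (Ioi (0 : ℝ))), F x = c := by
  -- Subtracting from a test function its integral times a fixed bump `χ` leaves the derivative of
  -- a test function, so `F` acts on test functions as the constant `∫ F χ`.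
  let B : ContDiffBump (1 : ℝ) := ⟨1 / 4, 1 / 2, by norm_num, by norm_num⟩
  set χ : ℝ → ℝ := B.normed volume with hχ
  have hχc : ContDiff ℝ ∞ χ := B.contDiff_normed
  have hχs : HasCompactSupport χ := B.hasCompactSupport_normed
  have hχt : tsupport χ = Metric.closedBall 1 (1 / 2) := B.tsupport_normed_eq
  have hχt' : tsupport χ ⊆ Ioi 0 := by
    rw [hχt, Real.closedBall_eq_Icc]
    intro x hx
    have := hx.1
    exact mem_Ioi.2 (by linarith)
  have hχ1 : ∫ x, χ x = 1 := B.integral_normed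
  set c := ∫ x in Ioi (0 : ℝ), F x * χ x with hc
  have hFg : ∀ g : ℝ → ℝ, ContDiff ℝ ∞ g → HasCompactSupport g → tsupport g ⊆ Ioi 0 →
      ∫ x in Ioi (0 : ℝ), F x * g x = c * ∫ x, g x := by
    intro g hg hgs hgt
    set m := ∫ x, g x with hm
    set k : ℝ → ℝ := fun x => g x - m * χ x with hk
    have hkc : ContDiff ℝ ∞ k := hg.sub (contDiff_const.mul hχc)
    set K := tsupport g ∪ tsupport χ with hK
    have hKc : IsCompact K := hgs.isCompact.union hχs.isCompact
    have hKne : K.Nonempty := ⟨1, Or.inr (by rw [hχt]; simp)⟩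
    have hk0 : ∀ x, x ∉ K → k x = 0 := fun x hx => by
      simp only [hk, image_eq_zero_of_notMem_tsupport (fun h => hx (Or.inl h)),
        image_eq_zero_of_notMem_tsupport (fun h => hx (Or.inr h)), mul_zero, sub_zero]
    obtain ⟨a, haK, ha⟩ := hKc.exists_isLeast hKne
    obtain ⟨R, hRK, hR⟩ := hKc.exists_isGreatest hKne
    have ha0 : 0 < a := union_subset hgt hχt' haK
    have hki : Integrable k :=
      (hg.continuous.integrable_of_hasCompactSupport hgs).sub
        ((hχc.continuous.integrable_of_hasCompactSupport hχs).const_mul m)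
    have hkint : ∫ x, k x = 0 := by
      rw [hk, integral_sub (hg.continuous.integrable_of_hasCompactSupport hgs)
        ((hχc.continuous.integrable_of_hasCompactSupport hχs).const_mul m), integral_const_mul, hχ1]
      simp [hm]
    set θ : ℝ → ℝ := fun x => ∫ t in Iic x, k t with hθ
    have hθd : ∀ x, HasDerivAt θ (k x) x := fun x => by
      have h1 : θ = fun x => (∫ t in Iic 0, k t) + ∫ t in (0 : ℝ)..x, k t := by
        ext y
        rw [← intervalIntegral.integral_Iic_sub_Iic hki.integrableOn hki.integrableOn,
          add_sub_cancel]
      rw [h1]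
      exact (hkc.continuous.integral_hasStrictDerivAt 0 x).hasDerivAt.const_add _
    have hθ' : deriv θ = k := funext fun x => (hθd x).deriv
    have hθc : ContDiff ℝ ∞ θ :=
      contDiff_infty_iff_deriv.2 ⟨fun x => (hθd x).differentiableAt, by rwa [hθ']⟩
    have hsub : Function.support θ ⊆ Icc a R := by
      intro x hx
      by_contra hxn
      refine hx ?_
      rw [mem_Icc, not_and_or, not_le, not_le] at hxn
      rcases hxn with hxa | hxR
      · refine (setIntegral_congr_fun measurableSet_Iic fun t ht => ?_).trans
          (integral_zero _ _)
        exact hk0 t fun htK => absurd (ha htK) (not_le.2 (lt_of_le_of_lt ht hxa))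
      · rw [hθ, ← hkint]
        refine setIntegral_eq_integral_of_forall_compl_eq_zero fun t ht => ?_
        refine hk0 t fun htK => ht ?_
        exact (hR htK).trans hxR.le
    have hts : tsupport θ ⊆ Icc a R := closure_minimal hsub isClosed_Icc
    have h0 := h θ hθc (isCompact_Icc.of_isClosed_subset (isClosed_tsupport θ) hts)
      (hts.trans fun x hx => ha0.trans_le hx.1)
    rw [hθ'] at h0
    have h1 : ∫ x in Ioi (0 : ℝ), F x * k x =
        (∫ x in Ioi (0 : ℝ), F x * g x) - (∫ x in Ioi (0 : ℝ), F x * χ x) * m := by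
      rw [← integral_mul_const, ← integral_sub
        (integrableOn_mul_of_hasCompactSupport hF hg.continuous hgs)
        ((integrableOn_mul_of_hasCompactSupport hF hχc.continuous hχs).mul_const m)]
      congr 1
      ext x
      simp only [hk]
      ring
    rw [h0] at h1
    linarith
  have hloc : LocallyIntegrableOn (fun x => F x - c) (Ioi 0) := by
    intro x hx
    refine ⟨Ioc 0 (x + 1), ?_, (hF _).sub (integrableOn_const measure_Ioc_lt_top.ne)⟩
    rw [← Ioi_inter_Iic]
    exact inter_mem self_mem_nhdsWithin (mem_nhdsWithin_of_mem_nhds (Iic_mem_nhds (by linarith)))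
  have hz := isOpen_Ioi.ae_eq_zero_of_integral_contDiff_smul_eq_zero hloc (fun g hg hgs hgt => by
    have hout : ∀ x, x ∉ Ioi (0 : ℝ) → g x = 0 := fun x hx =>
      image_eq_zero_of_notMem_tsupport fun h => hx (hgt h)
    have hgi : Integrable g := hg.continuous.integrable_of_hasCompactSupport hgs
    rw [← setIntegral_eq_integral_of_forall_compl_eq_zero (s := Ioi (0 : ℝ))
      (fun x hx => by rw [hout x hx, zero_smul])]
    have h1 := hFg g hg hgs hgt
    rw [← setIntegral_eq_integral_of_forall_compl_eq_zero (s := Ioi (0 : ℝ)) hout,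
      ← integral_const_mul] at h1
    rw [← sub_eq_zero, ← integral_sub
      (integrableOn_mul_of_hasCompactSupport hF hg.continuous hgs)
      (hgi.integrableOn.const_mul c)] at h1
    refine Eq.trans ?_ h1
    congr 1
    ext x
    rw [smul_eq_mul]
    ring)
  refine ⟨c, (ae_restrict_iff' measurableSet_Ioi).2 ?_⟩
  filter_upwards [hz] with x hx hx0
  exact sub_eq_zero.1 (hx hx0)

/-! ### Weak and integral form of the equation, uniqueness -/

/-- With `w(x) = exp (-x) φ(x)`, the equation reads `(weakDefect ξ φ)' = 0`, where
`weakDefect ξ φ = w - exp (-ξ) 1_{x > ξ} + 4 ∫_0^{x/2} exp (-z) w(z) dz`. -/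
noncomputable def weakDefect (ξ : ℝ) (φ : ℝ → ℝ) (x : ℝ) : ℝ :=
  Real.exp (-x) * φ x - Real.exp (-ξ) * (Ioi ξ).indicator 1 x +
    4 * ∫ z in (0 : ℝ)..x / 2, Real.exp (-z) * (Real.exp (-z) * φ z)

section Weak

variable {ξ : ℝ} {φ : ℝ → ℝ}

theorem integrableOn_exp_neg_mul_Ioc (hφ : ∀ R, IntegrableOn φ (Ioc 0 R)) (R : ℝ) :
    IntegrableOn (fun x => Real.exp (-x) * φ x) (Ioc 0 R) := by
  refine (hφ R).bdd_mul (c := 1) (by fun_prop) ?_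
  filter_upwards [ae_restrict_mem measurableSet_Ioc] with x hx
  rw [Real.norm_eq_abs, Real.abs_exp]
  exact Real.exp_le_one_iff.2 (by linarith [hx.1])

theorem integrableOn_indicator_Ioc (ξ R : ℝ) :
    IntegrableOn (fun x => Real.exp (-ξ) * (Ioi ξ).indicator 1 x) (Ioc 0 R) :=
  ((integrableOn_const (C := (1 : ℝ)) measure_Ioc_lt_top.ne).indicator measurableSet_Ioi).const_mul _

theorem integrableOn_primitive_half_Ioc (hφ : ∀ R, IntegrableOn φ (Ioc 0 R)) (R : ℝ) :
    IntegrableOn (fun x => ∫ z in (0 : ℝ)..x / 2, Real.exp (-z) * (Real.exp (-z) * φ z))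
      (Ioc 0 R) :=
  integrableOn_Ioc_of_continuousOn (continuousOn_primitive_half
    (integrableOn_exp_neg_mul_Ioc (integrableOn_exp_neg_mul_Ioc hφ))) R

theorem integrableOn_weakDefect (hφ : ∀ R, IntegrableOn φ (Ioc 0 R)) (R : ℝ) :
    IntegrableOn (weakDefect ξ φ) (Ioc 0 R) :=
  ((integrableOn_exp_neg_mul_Ioc hφ R).sub (integrableOn_indicator_Ioc ξ R)).add
    ((integrableOn_primitive_half_Ioc hφ R).const_mul 4)

theorem integrableOn_comp_half (hφ : ∀ R, IntegrableOn φ (Ioc 0 R)) (R : ℝ) :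
    IntegrableOn (fun x => φ (x / 2)) (Ioc 0 R) := by
  rcases le_total R 0 with h | h
  · rw [Ioc_eq_empty h.not_gt]
    exact integrableOn_empty
  · have h1 : IntervalIntegrable φ volume 0 (R / 2) :=
      (intervalIntegrable_iff_integrableOn_Ioc_of_le (by positivity)).2 (hφ _)
    have h2 := h1.comp_mul_left (c := 2⁻¹) 
    have h3 : IntervalIntegrable (fun x => φ (x / 2)) volume 0 R := by
      convert h2 using 1
      · ext x
        rw [div_eq_inv_mul]
      · simp
      · field_simp
    exact (intervalIntegrable_iff_integrableOn_Ioc_of_le h).1 h3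

/-- Testing `weakDefect` against the derivative of `exp x * ψ x` gives the weak form of the delay
equation tested against `ψ`. -/
theorem integral_weakDefect_mul_deriv (hξ : 0 < ξ) (hφ : ∀ R, IntegrableOn φ (Ioc 0 R))
    {ψ : ℝ → ℝ} (hψ : ContDiff ℝ ∞ ψ) (hs : HasCompactSupport ψ) :
    ∫ x in Ioi (0 : ℝ), weakDefect ξ φ x * deriv (fun x => Real.exp x * ψ x) x =
      (∫ x in Ioi (0 : ℝ), φ x * deriv ψ x) +
        (∫ x in Ioi (0 : ℝ), (φ x - 2 * φ (x / 2)) * ψ x) + ψ ξ := by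
  set θ : ℝ → ℝ := fun x => Real.exp x * ψ x with hθ
  have hθc : ContDiff ℝ ∞ θ := Real.contDiff_exp.mul hψ
  have hθs : HasCompactSupport θ := hs.mul_left
  have hθ1 : ContDiff ℝ 1 θ := hθc.of_le (by exact_mod_cast le_top)
  have hψ1 : ContDiff ℝ 1 ψ := hψ.of_le (by exact_mod_cast le_top)
  have hθ'c : Continuous (deriv θ) := hθ1.continuous_deriv le_rfl
  have hθ's : HasCompactSupport (deriv θ) := hθs.deriv
  have hθ' : ∀ x, deriv θ x = Real.exp x * (ψ x + deriv ψ x) := fun x => by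
    have := (Real.hasDerivAt_exp x).mul (hψ1.differentiable one_ne_zero x).hasDerivAt
    rw [show θ = Real.exp * ψ from rfl, this.deriv]
    ring
  have hcancel : ∀ x : ℝ, Real.exp (-x) * Real.exp x = 1 := fun x => by
    rw [← Real.exp_add, neg_add_cancel, Real.exp_zero]
  have i1 := integrableOn_mul_of_hasCompactSupport (integrableOn_exp_neg_mul_Ioc hφ) hθ'c hθ's
  have i2 := integrableOn_mul_of_hasCompactSupport (integrableOn_indicator_Ioc ξ) hθ'c hθ's
  have i3 := integrableOn_mul_of_hasCompactSupport (integrableOn_primitive_half_Ioc hφ) hθ'c hθ's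
  have j1 := integrableOn_mul_of_hasCompactSupport hφ hψ.continuous hs
  have j2 := integrableOn_mul_of_hasCompactSupport hφ (hψ1.continuous_deriv le_rfl) hs.deriv
  have j3 := integrableOn_mul_of_hasCompactSupport (integrableOn_comp_half hφ) hψ.continuous hs
  have t1 : ∫ x in Ioi (0 : ℝ), Real.exp (-x) * φ x * deriv θ x =
      (∫ x in Ioi (0 : ℝ), φ x * ψ x) + ∫ x in Ioi (0 : ℝ), φ x * deriv ψ x := by
    rw [← integral_add j1 j2]
    congr 1
    ext x
    rw [hθ']
    linear_combination φ x * (ψ x + deriv ψ x) * hcancel x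
  have t2 : ∫ x in Ioi (0 : ℝ), Real.exp (-ξ) * (Ioi ξ).indicator 1 x * deriv θ x = -ψ ξ := by
    have h1 : (fun x => Real.exp (-ξ) * (Ioi ξ).indicator 1 x * deriv θ x) =
        (Ioi ξ).indicator fun x => Real.exp (-ξ) * deriv θ x := by
      ext x
      by_cases h : x ∈ Ioi ξ <;> simp [h]
    rw [h1, setIntegral_indicator measurableSet_Ioi, Ioi_inter_Ioi, max_eq_right hξ.le,
      integral_const_mul, hθs.integral_Ioi_deriv_eq hθ1]
    simp only [hθ]
    linear_combination -ψ ξ * hcancel ξ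
  have t3 : ∫ x in Ioi (0 : ℝ), (∫ z in (0 : ℝ)..x / 2,
      Real.exp (-z) * (Real.exp (-z) * φ z)) * deriv θ x =
      -(1 / 2 * ∫ x in Ioi (0 : ℝ), φ (x / 2) * ψ x) := by
    rw [integral_deriv_mul_primitive_half
      (integrableOn_exp_neg_mul_Ioc (integrableOn_exp_neg_mul_Ioc hφ)) hθc hθs]
    have h1 := integral_comp_mul_left_Ioi (fun x => φ (x / 2) * ψ x) 0 (two_pos (α := ℝ))
    rw [mul_zero, smul_eq_mul] at h1
    rw [one_div, ← h1]
    congr 2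
    ext y
    simp only [hθ]
    rw [mul_div_cancel_left₀ y two_ne_zero, two_mul y, Real.exp_add]
    linear_combination φ y * ψ (y + y) * (1 + Real.exp (-y) * Real.exp y) * hcancel y
  have t4 : ∫ x in Ioi (0 : ℝ), (φ x - 2 * φ (x / 2)) * ψ x =
      (∫ x in Ioi (0 : ℝ), φ x * ψ x) - 2 * ∫ x in Ioi (0 : ℝ), φ (x / 2) * ψ x := by
    rw [← integral_const_mul, ← integral_sub j1 (j3.const_mul 2)]
    congr 1
    ext x
    ring
  have hsum : ∫ x in Ioi (0 : ℝ), weakDefect ξ φ x * deriv θ x =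
      (∫ x in Ioi (0 : ℝ), Real.exp (-x) * φ x * deriv θ x) -
        (∫ x in Ioi (0 : ℝ), Real.exp (-ξ) * (Ioi ξ).indicator 1 x * deriv θ x) +
        4 * ∫ x in Ioi (0 : ℝ), (∫ z in (0 : ℝ)..x / 2,
          Real.exp (-z) * (Real.exp (-z) * φ z)) * deriv θ x := by
    rw [← integral_const_mul, ← integral_sub i1 i2]
    refine Eq.trans ?_ (integral_add (i1.sub i2) (i3.const_mul 4))
    congr 1
    ext x
    simp only [weakDefect]
    ring
  rw [hsum, t1, t2, t3, t4]
  ring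

end Weak

theorem IsSolution.integrableOn_Ioc {ξ : ℝ} {φ : ℝ → ℝ} (h : IsSolution ξ φ) (R : ℝ) :
    IntegrableOn φ (Ioc 0 R) := by
  have h1 : ∀ᶠ x in 𝓝[Ici 0] (0 : ℝ), |φ x| < 1 := by
    have h0 : Tendsto (fun x => |φ x|) (𝓝[Ici 0] 0) (𝓝 |φ 0|) := h.continuousWithinAt_zero.abs
    rw [h.map_zero, abs_zero] at h0
    exact h0.eventually (gt_mem_nhds one_pos)
  obtain ⟨δ, hδ, hδφ⟩ := mem_nhdsGE_iff_exists_Icc_subset.1 h1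
  have hδ0 : (0 : ℝ) < δ := hδ
  have h2 : IntegrableOn φ (Ioc 0 δ) := by
    refine (integrableOn_const (C := (1 : ℝ)) measure_Ioc_lt_top.ne).mono'
      (h.locallyIntegrableOn.aestronglyMeasurable.mono_set Ioc_subset_Ioi_self) ?_
    filter_upwards [ae_restrict_mem measurableSet_Ioc] with x hx
    exact (show |φ x| < 1 from hδφ ⟨hx.1.le, hx.2⟩).le
  have h3 : IntegrableOn φ (Icc δ R) :=
    h.locallyIntegrableOn.integrableOn_compact_subset
      (fun x hx => hδ0.trans_le hx.1) isCompact_Icc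
  refine (h2.union h3).mono_set fun x hx => ?_
  rcases le_total x δ with hxδ | hxδ
  · exact Or.inl ⟨hx.1, hxδ⟩
  · exact Or.inr ⟨hxδ, hx.2⟩

/-- Every solution satisfies the integral equation almost everywhere: the constant furnished by the
du Bois-Reymond lemma is the limit of `weakDefect` at `0`. -/
theorem IsSolution.weakDefect_ae_eq_zero {ξ : ℝ} {φ : ℝ → ℝ} (hξ : 0 < ξ) (h : IsSolution ξ φ) :
    ∀ᵐ x ∂(volume.restrict (Ioi (0 : ℝ))), weakDefect ξ φ x = 0 := by
  have hφ := h.integrableOn_Ioc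
  obtain ⟨c, hc⟩ := ae_eq_const_of_integral_mul_deriv_eq_zero
    (integrableOn_weakDefect (ξ := ξ) hφ) (fun θ hθ hs ht => by
      have hψ : ContDiff ℝ ∞ fun x => Real.exp (-x) * θ x :=
        (Real.contDiff_exp.comp contDiff_neg).mul hθ
      have hψs : HasCompactSupport fun x => Real.exp (-x) * θ x := hs.mul_left
      have h1 := integral_weakDefect_mul_deriv hξ hφ hψ hψs
      have h2 := h.equation _ hψ hψs ((tsupport_mul_subset_right).trans ht)
      have h3 : (fun x => Real.exp x * (Real.exp (-x) * θ x)) = θ := by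
        ext x
        rw [← mul_assoc, ← Real.exp_add, add_neg_cancel, Real.exp_zero, one_mul]
      rw [h3] at h1
      rw [h1]
      linarith)
  have hlim : Tendsto (weakDefect ξ φ) (𝓝[>] 0) (𝓝 0) := by
    have hφ0 : Tendsto φ (𝓝[>] 0) (𝓝 0) := by
      have := h.continuousWithinAt_zero.mono Ioi_subset_Ici_self
      unfold ContinuousWithinAt at this
      rwa [h.map_zero] at this
    have he : Tendsto (fun x : ℝ => Real.exp (-x)) (𝓝[>] 0) (𝓝 1) := by
      have : Continuous fun x : ℝ => Real.exp (-x) := by fun_prop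
      simpa using (this.tendsto 0).mono_left nhdsWithin_le_nhds
    have hi : Tendsto (fun x => Real.exp (-ξ) * (Ioi ξ).indicator (1 : ℝ → ℝ) x)
        (𝓝[>] 0) (𝓝 0) := by
      refine tendsto_const_nhds.congr' ?_
      filter_upwards [mem_nhdsWithin_of_mem_nhds (Iio_mem_nhds hξ)] with x hx
      rw [indicator_of_notMem (by simpa using (mem_Iio.1 hx).le), mul_zero]
    have hp : Tendsto (fun x => ∫ z in (0 : ℝ)..x / 2, Real.exp (-z) * (Real.exp (-z) * φ z))
        (𝓝[>] 0) (𝓝 0) := by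
      have := (continuousOn_primitive_half (integrableOn_exp_neg_mul_Ioc
        (integrableOn_exp_neg_mul_Ioc hφ)) 0 self_mem_Ici).mono Ioi_subset_Ici_self
      unfold ContinuousWithinAt at this
      simpa using this
    have := ((he.mul hφ0).sub hi).add (hp.const_mul 4)
    rwa [mul_zero, mul_zero, sub_zero, add_zero] at this
  have hc0 : c = 0 := by
    by_contra hne
    have h1 : ∀ᶠ x in 𝓝[>] (0 : ℝ), weakDefect ξ φ x ≠ c :=
      hlim.eventually_ne (Ne.symm hne)
    obtain ⟨u, hu, hsub⟩ := mem_nhdsGT_iff_exists_Ioo_subset.1 h1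
    have h2 : volume (Ioo 0 u) = 0 := by
      have h3 := (ae_restrict_iff' measurableSet_Ioi).1 hc
      refine measure_mono_null (fun x hx => ?_) h3
      exact fun hx' => hsub hx (hx' hx.1)
    rw [Real.volume_Ioo, ENNReal.ofReal_eq_zero, sub_zero] at h2
    exact absurd hu (not_lt.2 h2)
  rwa [hc0] at hc

/-- A continuous solution of the homogeneous integral equation vanishes: on `[0, 1/4]` the
right-hand side contracts the maximum of `|d|`, and Grönwall does the rest. -/
theorem eq_zero_of_homogeneous {d : ℝ → ℝ} (hc : ContinuousOn d (Ici 0))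
    (hd : ∀ x, 0 ≤ x → d x = -(4 * ∫ z in (0 : ℝ)..x / 2, Real.exp (-z) * d z)) {x : ℝ}
    (hx : 0 ≤ x) : d x = 0 := by
  have hi : ∀ y, 0 ≤ y → IntervalIntegrable (fun z => Real.exp (-z) * |d z|) volume 0 y := by
    intro y hy
    refine ContinuousOn.intervalIntegrable ?_
    rw [uIcc_of_le hy]
    exact (by fun_prop : Continuous fun z : ℝ => Real.exp (-z)).continuousOn.mul
      (hc.mono Icc_subset_Ici_self).abs
  have hle : ∀ x, 0 ≤ x → |d x| ≤ 4 * ∫ z in (0 : ℝ)..x / 2, Real.exp (-z) * |d z| := by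
    intro x hx
    have h1 := abs_integral_exp_neg_mul_le (v := d) (x := x / 2) (by positivity)
    conv_lhs => rw [hd x hx, abs_neg, abs_mul, abs_of_pos (by norm_num : (0 : ℝ) < 4)]
    gcongr
  obtain ⟨m, hm, hmax⟩ := (isCompact_Icc (a := (0 : ℝ)) (b := 1 / 4)).exists_isMaxOn
    ⟨0, by norm_num⟩ (hc.mono Icc_subset_Ici_self).abs
  have hM0 : |d m| = 0 := by
    have h1 : ∫ z in (0 : ℝ)..m / 2, Real.exp (-z) * |d z| ≤ ∫ z in (0 : ℝ)..m / 2, |d m| := by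
      refine intervalIntegral.integral_mono_on (by linarith [hm.1]) (hi _ (by linarith [hm.1]))
        intervalIntegrable_const fun z hz => ?_
      have hz' : |d z| ≤ |d m| := hmax ⟨hz.1, by linarith [hz.2, hm.1, hm.2]⟩
      refine (mul_le_of_le_one_left (abs_nonneg _) (Real.exp_le_one_iff.2 ?_)).trans hz'
      linarith [hz.1]
    rw [intervalIntegral.integral_const, smul_eq_mul, sub_zero] at h1
    have h2 := hle m hm.1
    have h3 := mul_le_mul_of_nonneg_right hm.2 (abs_nonneg (d m))
    have := abs_nonneg (d m)
    linarith
  have h := abs_le_of_le_add_integral_half (f := d) (a := 0) (η := 1 / 4) (by norm_num) le_rfl hi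
    (fun x hx hx' => (hmax ⟨hx, hx'.le⟩ : |d x| ≤ |d m|).trans_eq hM0)
    (fun x hx' => by
      rw [zero_add]
      exact hle x (by linarith)) hx
  rw [zero_mul] at h
  exact abs_eq_zero.1 (le_antisymm h (abs_nonneg _))

theorem ae_eq_of_weakDefect_ae_eq_zero {ξ : ℝ} {φ χ : ℝ → ℝ}
    (hφ : ∀ R, IntegrableOn φ (Ioc 0 R)) (hχ : ∀ R, IntegrableOn χ (Ioc 0 R))
    (h₁ : ∀ᵐ x ∂(volume.restrict (Ioi (0 : ℝ))), weakDefect ξ φ x = 0)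
    (h₂ : ∀ᵐ x ∂(volume.restrict (Ioi (0 : ℝ))), weakDefect ξ χ x = 0) :
    ∀ᵐ x ∂(volume.restrict (Ioi (0 : ℝ))), φ x = χ x := by
  set w : ℝ → ℝ := fun x => Real.exp (-x) * (φ x - χ x) with hw
  have hwi : ∀ R, IntegrableOn (fun x => Real.exp (-x) * w x) (Ioc 0 R) :=
    integrableOn_exp_neg_mul_Ioc (integrableOn_exp_neg_mul_Ioc fun R => (hφ R).sub (hχ R))
  -- The continuous representative of `w`.
  set d : ℝ → ℝ := fun x => -(4 * ∫ z in (0 : ℝ)..x / 2, Real.exp (-z) * w z) with hd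
  have hdc : ContinuousOn d (Ici 0) :=
    ((continuousOn_primitive_half hwi).const_mul 4).neg
  have hwd : ∀ᵐ x ∂(volume.restrict (Ioi (0 : ℝ))), w x = d x := by
    filter_upwards [h₁, h₂, ae_restrict_mem measurableSet_Ioi] with x hx₁ hx₂ hx
    have hx0 : 0 ≤ x / 2 := by have := mem_Ioi.1 hx; positivity
    have hint : ∫ z in (0 : ℝ)..x / 2, Real.exp (-z) * w z =
        (∫ z in (0 : ℝ)..x / 2, Real.exp (-z) * (Real.exp (-z) * φ z)) -
          ∫ z in (0 : ℝ)..x / 2, Real.exp (-z) * (Real.exp (-z) * χ z) := by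
      rw [← intervalIntegral.integral_sub
        ((intervalIntegrable_iff_integrableOn_Ioc_of_le hx0).2
          (integrableOn_exp_neg_mul_Ioc (integrableOn_exp_neg_mul_Ioc hφ) _))
        ((intervalIntegrable_iff_integrableOn_Ioc_of_le hx0).2
          (integrableOn_exp_neg_mul_Ioc (integrableOn_exp_neg_mul_Ioc hχ) _))]
      simp only [hw, mul_sub]
    simp only [hd]
    rw [hint]
    simp only [weakDefect] at hx₁ hx₂
    simp only [hw]
    linarith
  have hdd : ∀ x, 0 ≤ x → d x = -(4 * ∫ z in (0 : ℝ)..x / 2, Real.exp (-z) * d z) := by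
    intro x hx
    have hx0 : 0 ≤ x / 2 := by positivity
    simp only [hd]
    rw [intervalIntegral.integral_of_le hx0, intervalIntegral.integral_of_le hx0]
    congr 2
    refine integral_congr_ae ?_
    filter_upwards [ae_restrict_of_ae_restrict_of_subset Ioc_subset_Ioi_self hwd] with z hz
    rw [hz]
  filter_upwards [hwd, ae_restrict_mem measurableSet_Ioi] with x hx hx0
  rw [eq_zero_of_homogeneous hdc hdd (mem_Ioi.1 hx0).le] at hx
  exact sub_eq_zero.1 ((mul_eq_zero.1 hx).resolve_left (Real.exp_pos _).ne')

/-- The fundamental solution `G(x, ξ) = exp (x - ξ) U(x, ξ)`. -/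
noncomputable def fundSol (x ξ : ℝ) : ℝ := Real.exp (x - ξ) * normSol ξ x

theorem fundSol_eq_zero {x ξ : ℝ} (hξ : 0 < ξ) (hx : x ≤ ξ) : fundSol x ξ = 0 := by
  rw [fundSol, normSol_eq_zero hξ hx, mul_zero]

theorem weakDefect_fundSol {ξ : ℝ} (hξ : 0 < ξ) (x : ℝ) :
    weakDefect ξ (fun x => fundSol x ξ) x = 0 := by
  have h : ∀ x, Real.exp (-x) * fundSol x ξ = Real.exp (-ξ) * normSol ξ x := fun x => by
    rw [fundSol, ← mul_assoc, ← Real.exp_add]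
    ring_nf
  have h2 : ∀ z, Real.exp (-z) * (Real.exp (-z) * fundSol z ξ) =
      Real.exp (-ξ) * (Real.exp (-z) * normSol ξ z) := fun z => by
    rw [h]
    ring
  simp only [weakDefect, h2]
  rw [h, intervalIntegral.integral_const_mul]
  linear_combination Real.exp (-ξ) * normSol_eq hξ x

theorem continuousOn_fundSol {ξ : ℝ} (hξ : 0 < ξ) :
    ContinuousOn (fun x => fundSol x ξ) {ξ}ᶜ := by
  have hp : Continuous fun x : ℝ => ∫ z in (0 : ℝ)..x / 2, Real.exp (-z) * normSol ξ z :=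
    (intervalIntegral.continuous_primitive (intervalIntegrable_exp_neg_mul
      (measurable_normSol hξ) (abs_normSol_le hξ)) 0).comp (continuous_id.div_const 2)
  have hU : ContinuousOn (normSol ξ) {ξ}ᶜ := by
    rw [show normSol ξ = fun x => (Ioi ξ).indicator 1 x -
      4 * ∫ z in (0 : ℝ)..x / 2, Real.exp (-z) * normSol ξ z from funext (normSol_eq hξ)]
    refine ContinuousOn.sub (fun x hx => ?_) (hp.const_mul 4).continuousOn
    refine ContinuousAt.continuousWithinAt ?_
    refine continuousAt_const (y := (Ioi ξ).indicator (1 : ℝ → ℝ) x) |>.congr ?_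
    rcases lt_or_gt_of_ne hx with h | h
    · filter_upwards [Iio_mem_nhds h] with y hy
      rw [indicator_of_notMem (by simpa using h.le),
        indicator_of_notMem (by simpa using (mem_Iio.1 hy).le)]
    · filter_upwards [Ioi_mem_nhds h] with y hy
      rw [indicator_of_mem (mem_Ioi.2 h), indicator_of_mem hy]
      rfl
  exact (by fun_prop : Continuous fun x : ℝ => Real.exp (x - ξ)).continuousOn.mul hU

theorem integrableOn_fundSol {ξ : ℝ} (hξ : 0 < ξ) (R : ℝ) :
    IntegrableOn (fun x => fundSol x ξ) (Ioc 0 R) :=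
  (((by fun_prop : Continuous fun x : ℝ => Real.exp (x - ξ)).integrableOn_Icc).mono_set
    Ioc_subset_Icc_self).mul_bdd (measurable_normSol hξ).aestronglyMeasurable
      (ae_of_all _ (abs_normSol_le hξ))

theorem isSolution_fundSol {ξ : ℝ} (hξ : 0 < ξ) : IsSolution ξ fun x => fundSol x ξ where
  locallyIntegrableOn := by
    intro x _
    refine ⟨Ioc 0 (x + 1), ?_, integrableOn_fundSol hξ _⟩
    rw [← Ioi_inter_Iic]
    exact inter_mem self_mem_nhdsWithin (mem_nhdsWithin_of_mem_nhds (Iic_mem_nhds (by linarith)))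
  equation := by
    intro ψ hψ hs _
    have h := integral_weakDefect_mul_deriv hξ (integrableOn_fundSol hξ) hψ hs
    simp only [weakDefect_fundSol hξ, zero_mul, integral_zero] at h
    linarith
  map_zero := fundSol_eq_zero hξ hξ.le
  continuousWithinAt_zero :=
    ((continuousOn_fundSol hξ).continuousAt
      (isOpen_compl_singleton.mem_nhds hξ.ne)).continuousWithinAt

theorem exp_half_sub_le {β x ξ : ℝ} (hβ : β < 1 / 2) (hξ : 0 < ξ) (hx : ξ < x) :
    Real.exp (x / 2 - ξ) ≤ Real.exp ((1 - β) * (x - ξ)) := by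
  refine Real.exp_le_exp.2 ?_
  nlinarith [mul_pos (sub_pos.2 hβ) (sub_pos.2 hx)]

end DelayEq

theorem lemmaA1 :
    ∃ G Gt : ℝ → ℝ → ℝ,
      -- `G(·, ξ)` is the solution, unique up to null sets, continuous away from the source
      (∀ ξ : ℝ, 0 < ξ →
        DelayEq.IsSolution ξ (fun x => G x ξ) ∧
        ContinuousOn (fun x => G x ξ) (Ici 0 \ {ξ}) ∧
        ∀ φ : ℝ → ℝ, DelayEq.IsSolution ξ φ →
          ∀ᵐ x ∂(volume.restrict (Ioi (0 : ℝ))), φ x = G x ξ) ∧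
      -- `G` vanishes before the source
      (∀ ξ x : ℝ, 0 < ξ → x < ξ → G x ξ = 0) ∧
      -- the series defining `Q` converges absolutely, and `G` has the representation
      (∀ ξ : ℝ, 0 < ξ → Summable (fun n : ℕ => DelayEq.QTerm (n + 1) ξ)) ∧
      (∀ ξ x : ℝ, 0 < ξ → ξ < x → G x ξ = Real.exp x * DelayEq.Q ξ + Gt x ξ) ∧
      -- the bounds, with a constant that depends only on `β`
      (∀ β : ℝ, 0 < β → β < 1 / 2 → ∃ C₀ : ℝ, 0 < C₀ ∧
        (∀ ξ : ℝ, 0 < ξ → |DelayEq.Q ξ| ≤ C₀ * Real.exp (-ξ)) ∧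
        (∀ ξ₁ ξ₂ : ℝ, 0 < ξ₁ → ξ₁ < ξ₂ →
          |Real.exp ξ₁ * DelayEq.Q ξ₁ - Real.exp ξ₂ * DelayEq.Q ξ₂| ≤
            C₀ * Real.exp (-ξ₁) * |ξ₁ - ξ₂|) ∧
        (∀ ξ x : ℝ, 0 < ξ → ξ < x → |Gt x ξ| ≤ C₀ * Real.exp ((1 - β) * (x - ξ))) ∧
        (∀ ξ₁ ξ₂ x : ℝ, 0 < ξ₁ → ξ₁ < ξ₂ → ξ₂ < x →
          |Gt x ξ₁ - Gt x ξ₂| ≤ C₀ * |ξ₁ - ξ₂| * Real.exp ((1 - β) * (x - ξ₁))) ∧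
        (∀ ξ x₁ x₂ : ℝ, 0 < ξ → ξ < x₁ → x₁ < x₂ →
          |Gt x₁ ξ - Gt x₂ ξ| ≤ C₀ * |x₁ - x₂| * Real.exp ((1 - β) * (x₂ - ξ)))) := by
  refine ⟨DelayEq.fundSol, DelayEq.remainder, fun ξ hξ => ⟨DelayEq.isSolution_fundSol hξ,
    (DelayEq.continuousOn_fundSol hξ).mono fun x hx => hx.2, fun φ hφ => ?_⟩,
    fun ξ x hξ hx => DelayEq.fundSol_eq_zero hξ hx.le,
    fun ξ hξ => (summable_nat_add_iff (f := fun n => DelayEq.QTerm n ξ) 1).2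
      (DelayEq.summable_QTerm hξ.le),
    fun ξ x hξ hx => DelayEq.exp_mul_normSol_eq hξ hx, fun β _ hβ => ?_⟩
  · exact DelayEq.ae_eq_of_weakDefect_ae_eq_zero hφ.integrableOn_Ioc
      (DelayEq.integrableOn_fundSol hξ) (hφ.weakDefect_ae_eq_zero hξ)
      (ae_of_all _ (DelayEq.weakDefect_fundSol hξ))
  · have hK : 1 ≤ Real.exp 4 := Real.one_le_exp (by norm_num)
    have hK2 : Real.exp 4 ≤ Real.exp 4 ^ 2 := le_self_pow₀ hK two_ne_zero
    -- The largest requirement is `8 * exp 4 + 16 * exp 4 ^ 2 ≤ C₀`, from the dependence of the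
    -- remainder on the source.
    refine ⟨24 * Real.exp 4 ^ 2, by positivity, fun ξ hξ => ?_, fun ξ₁ ξ₂ h₁ h₂ => ?_,
      fun ξ x hξ hx => ?_, fun ξ₁ ξ₂ x h₁ h₂ hx => ?_, fun ξ x₁ x₂ hξ hx₁ hx₂ => ?_⟩
    · rw [← DelayEq.exp_neg_mul_normLimit hξ, abs_mul, Real.abs_exp, mul_comm]
      exact mul_le_mul_of_nonneg_right
        ((DelayEq.abs_normLimit_le hξ).trans (by linarith)) (Real.exp_nonneg _)
    · refine (DelayEq.abs_exp_mul_Q_sub_le h₁ h₂).trans ?_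
      gcongr ?_ * _ * _
      linarith
    · refine (DelayEq.abs_remainder_le hξ).trans ?_
      gcongr ?_ * ?_
      · linarith
      · exact DelayEq.exp_half_sub_le hβ hξ hx
    · refine (DelayEq.abs_remainder_sub_source_le h₁ h₂).trans ?_
      have hδ := sub_pos.2 h₂
      rw [abs_sub_comm, abs_of_pos hδ]
      gcongr ?_ * _ * ?_
      · linarith
      · exact DelayEq.exp_half_sub_le hβ h₁ (h₂.trans hx)
    · refine (DelayEq.abs_remainder_sub_le hξ hx₂).trans ?_
      have hδ := sub_pos.2 hx₂
      rw [abs_sub_comm, abs_of_pos hδ]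
      gcongr ?_ * _ * ?_
      · linarith
      · exact DelayEq.exp_half_sub_le hβ hξ (hx₁.trans hx₂)
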